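/- **Setting.** Let $\mathcal X$ be a measurable space (e.g. a Borel subset of $\mathbb R^d$), $\mathcal Y=\{-1,+1\}$, $\mathrm p^*$ a probability distribution on $\mathcal X\times\mathcal Y$, and $\rho_{\pm1}:\mathcal X\to[0,1]$ measurable. Let $\mathrm p^{\mathrm{tr}}$ be the distribution of a pair $(x,y)\sim \mathrm p^*$ whose label is then flipped with probability $\rho_y(x)$, and $P_{\mathrm{noise}}=\mathbb E_{\mathrm p^*}\{\rho_y(x)\}$. Let $\mathcal H=\{\hbar_1,\dots,\hbar_T\}$ be a finite set of measurable functions $\mathcal X\to[-1,1]$, closed under negation, $\boldsymbol\hbar=(\hbar_1,\dots,\hbar_T)^\top$, and let $(x_1,y_1),\dots,(x_n,y_n)$ be i.i.d. from $\mathrm p^{\mathrm{tr}}$, $n\ge1$. Let $\lambda>0$. A (randomized) classification rule is given by measurable probabilities $\mathrm h(y|x)$; its error probability is $R(\mathrm h)=\mathbb E_{\mathrm p^*}\{1-\mathrm h(y|x)\}$. For $\boldsymbol\mu\in\mathbb R^T$ let $\mathrm h_{\boldsymbol\mu}(y|x)=[\,y\boldsymbol\hbar(x)^\top\boldsymbol\mu+1/2\,]_0^1$,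 where $[z]_0^1=\max(\min(z,1),0)$. Let $\mathcal U$ be the set of probability distributions $\mathrm p$ on $\mathcal X\times\mathcal Y$ with $|\mathbb E_{\mathrm p}\{y\hbar(x)\}-\frac1n\sum_i y_i\hbar(x_i)|\le\lambda$ for all $\hbar\in\mathcal H$, and let $\overline R=\inf_{\mathrm h}\sup_{\mathrm p\in\mathcal U}\mathbb E_{\mathrm p}\{1-\mathrm h(y|x)\}$ be the minimax risk. The learning problem is $$\min_{\boldsymbol\mu}\ F(\boldsymbol\mu)=\tfrac12-\tfrac1n\sum_{i=1}^n y_i\boldsymbol\hbar(x_i)^\top\boldsymbol\mu+\lambda\|\boldsymbol\mu\|_1\quad\text{s.t. } |\boldsymbol\hbar(x)^\top\boldsymbol\mu|\le\tfrac12\ \ \forall x\in\mathcal X,\qquad(\mathrm{dual})$$ and $\boldsymbol\mu$ is called an $\varepsilon$-optimal solution of it if $(F(\boldsymbol\mu)-\overline R)+\mathbb E_{\mathrm p^*_x}(|\boldsymbol\hbar(x)^\top\boldsymbol\mu|-\frac12)_+\le\varepsilon$. **Algorithm 1 (column generation).** Start with $\mathcal H^{(0)}=\emptyset$, $\boldsymbol\mu^{(0)}=\mathbf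 0$, $R^{(0)}=1/2$, $w_i=1/n$, $\tilde y_i=y_i$. At round $k=1,2,\dots$: (Step 3) a base learner returns some $\hbar\in\mathcal H$; (Step 5) if $\sum_i w_i\tilde y_i\hbar(x_i)\le\lambda$ stop, with $\boldsymbol\mu^{(k)}=\boldsymbol\mu^{(k-1)}$, $R^{(k)}=R^{(k-1)}$; otherwise put $\mathcal A=\mathcal H^{(k-1)}\cup\{\hbar\}$, take a solution $(\boldsymbol\mu_+,\boldsymbol\mu_-)$ of the linear program that minimizes $$\tfrac12-\tfrac1n\sum_i y_i\boldsymbol\hbar(x_i)^\top(\boldsymbol\mu_+-\boldsymbol\mu_-)+\lambda\mathbf 1^\top(\boldsymbol\mu_++\boldsymbol\mu_-)$$ over $\boldsymbol\mu_\pm\succeq\mathbf 0$ supported on $\mathcal A$ with $|\boldsymbol\hbar(x_i)^\top(\boldsymbol\mu_+-\boldsymbol\mu_-)|\le\frac12$ for $i=1,\dots,n$, and a solution $(\boldsymbol\alpha,\boldsymbol\beta)$ of its dual, which maximizes $\frac12(1-\mathbf 1^\top(\boldsymbol\alpha+\boldsymbol\beta))$ over $\boldsymbol\alpha,\boldsymbol\beta\succeq\mathbf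 0$ with $|\sum_i\hbar(x_i)(\alpha_i-\beta_i-y_i/n)|\le\lambda$ for $\hbar\in\mathcal A$. Set $\boldsymbol\mu^{(k)}=\boldsymbol\mu_+-\boldsymbol\mu_-$, $R^{(k)}$ the optimal value, $w_i=|y_i/n-(\alpha_i-\beta_i)|$, $\tilde y_i=\mathrm{sign}(y_i/n-(\alpha_i-\beta_i))$, and let $\mathcal H^{(k)}$ be $\mathcal A$ without the base-rules $\hbar$ with $\sum_iw_i\tilde y_i\hbar(x_i)<\lambda$. **Theorem.** Let $\mathcal D$ be the VC-dimension of $\mathcal H$ (the VC-dimension of the subgraphs $\{(x,t):t<\hbar(x)\}$, $\hbar\in\mathcal H$, which is the usual VC-dimension if the base-rules take values in $\{-1,1\}$), assume $\mathcal D\le n$, and let $0<\delta<1$. For $\boldsymbol\mu\in\mathbb R^T$ let $\varepsilon(\delta)=0$ if $\|\boldsymbol\mu\|_1\le 1/2$, and otherwise $$\varepsilon(\delta)=2\|\boldsymbol\mu\|_1\sqrt{\frac{2\mathcal D\log(3n/\mathcal D)}{n}}+\Big(\|\boldsymbol\mu\|_1-\frac12\Big)\sqrt{\frac{\log(1/\delta)}{2n}}$$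 (the first term being $0$ if $\mathcal D=0$). With probability at least $1-\delta$ over the training samples the following holds for every run of Algorithm 1 and every $k$. 1. For every $\varepsilon_{\mathrm{est}}$ with $|\mathbb E_{\mathrm p^{\mathrm{tr}}}\{y\hbar(x)\}-\frac1n\sum_i y_i\hbar(x_i)|\le\varepsilon_{\mathrm{est}}$ for all $\hbar\in\mathcal H$, $$R(\mathrm h_{\boldsymbol\mu^{(k)}})\le R^{(k)}+\varepsilon(\delta)+(\varepsilon_{\mathrm{est}}+2P_{\mathrm{noise}}-\lambda)\|\boldsymbol\mu^{(k)}\|_1,$$ where $\varepsilon(\delta)$ is taken at $\boldsymbol\mu=\boldsymbol\mu^{(k)}$. 2. If the algorithm stops at round $k$ in Step 5 and the base-rule returned by the base learner at that round maximizes $\sum_iw_i\tilde y_i\hbar(x_i)$ over $\hbar\in\mathcal H$, then $\boldsymbol\mu^{(k)}$ is an $\varepsilon(\delta)$-optimal solution of (dual). -/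

import Mathlib

open MeasureTheory

noncomputable section

namespace RMBoost

/-- The labels `{-1, +1}` are encoded by `Bool` (`true` is `+1`, `false` is `-1`);
`!y` is the opposite label and `lab y` is the numerical value of the label `y`. -/
def lab (y : Bool) : ℝ := if y then 1 else -1

/-- A (possibly randomized) classification rule: `prob y x` is the probability `h(y|x)` with which
the label `y` is assigned to the instance `x`. -/
structure Rule (X : Type*) [MeasurableSpace X] where
  prob : Bool → X → ℝ
  measurable_prob : ∀ y, Measurable (prob y)
  prob_nonneg : ∀ y x, 0 ≤ prob y x
  prob_add : ∀ x, prob true x + prob false x = 1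

/-- A finite set of base-rules `ħ_1, …, ħ_T`: measurable functions with values in `[-1, 1]`,
the set being closed under negation. -/
structure BaseRules (X : Type*) [MeasurableSpace X] (T : ℕ) where
  rule : Fin T → X → ℝ
  measurable_rule : ∀ j, Measurable (rule j)
  abs_rule_le : ∀ j x, |rule j x| ≤ 1
  exists_neg : ∀ j, ∃ j', ∀ x, rule j' x = -rule j x

variable {X : Type*} [MeasurableSpace X] {T n : ℕ}

/-- The error probability of the rule `h` under the distribution `p`: expected 0-1 loss. -/
def risk (p : Measure (X × Bool)) (h : Rule X) : ℝ := ∫ z, (1 - h.prob z.2 z.1) ∂p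

/-- `ħ(x)ᵀ μ`. -/
def comb (H : BaseRules X T) (μ : Fin T → ℝ) (x : X) : ℝ := ∑ j, H.rule j x * μ j

/-- The `1`-norm. -/
def norm1 (μ : Fin T → ℝ) : ℝ := ∑ j, |μ j|

/-- The clip function `[z]_0^1`. -/
def clip (z : ℝ) : ℝ := max (min z 1) 0

theorem clip_add_clip (a : ℝ) : clip (a + 1 / 2) + clip (-a + 1 / 2) = 1 := by
  unfold clip
  rcases le_total a (1 / 2) with h | h <;> rcases le_total (-a) (1 / 2) with h' | h'
  · rw [min_eq_left (by linarith), min_eq_left (by linarith), max_eq_left (by linarith),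
      max_eq_left (by linarith)]
    ring
  · rw [min_eq_left (by linarith), min_eq_right (by linarith), max_eq_right (by linarith),
      max_eq_left (by linarith)]
    ring
  · rw [min_eq_right (by linarith), min_eq_left (by linarith), max_eq_left (by linarith),
      max_eq_right (by linarith)]
    ring
  · linarith

theorem measurable_comb (H : BaseRules X T) (μ : Fin T → ℝ) : Measurable (comb H μ) :=
  Finset.measurable_sum _ fun j _ => (H.measurable_rule j).mul_const (μ j)

/-- The classification rule `h_μ`, with `h_μ(y|x) = [y ħ(x)ᵀ μ + 1/2]_0^1`. -/
def ruleOf (H : BaseRules X T) (μ : Fin T → ℝ) : Rule X where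
  prob y x := clip (lab y * comb H μ x + 1 / 2)
  measurable_prob y :=
    ((((measurable_comb H μ).const_mul (lab y)).add_const (1 / 2)).min measurable_const).max
      measurable_const
  prob_nonneg _ _ := le_max_right _ _
  prob_add x := by
    have h := clip_add_clip (comb H μ x)
    simpa [lab] using h

/-- The distribution of a training sample: an instance-label pair `(x, y)` is drawn from `p`, and
then the label `y` is flipped with probability `ρ y x`. -/
def trainDist (p : Measure (X × Bool)) (ρ : Bool → X → ℝ) : Measure (X × Bool) :=
  p.withDensity (fun z => ENNReal.ofReal (1 - ρ z.2 z.1)) +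
    (p.withDensity (fun z => ENNReal.ofReal (ρ z.2 z.1))).map (fun z => (z.1, !z.2))

/-- The probability with which a label is incorrect at training. -/
def pNoise (p : Measure (X × Bool)) (ρ : Bool → X → ℝ) : ℝ := ∫ z, ρ z.2 z.1 ∂p

/-- The training average `(1/n) ∑ i, y_i ħ_j(x_i)`. -/
def empMean (H : BaseRules X T) (S : Fin n → X × Bool) (j : Fin T) : ℝ :=
  (1 / (n : ℝ)) * ∑ i, lab (S i).2 * H.rule j (S i).1

/-- `ε` bounds the error of the training averages of the base-rules, for the training
distribution `q`. -/
def IsEstBound (H : BaseRules X T) (q : Measure (X × Bool)) (S : Fin n → X × Bool) (ε : ℝ) :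
    Prop :=
  ∀ j, |(∫ z, lab z.2 * H.rule j z.1 ∂q) - empMean H S j| ≤ ε

/-- The uncertainty set: distributions whose expectations of the base-rules differ from the
training averages by at most `lam`. -/
def uncertaintySet (H : BaseRules X T) (S : Fin n → X × Bool) (lam : ℝ) :
    Set (ProbabilityMeasure (X × Bool)) :=
  {p | ∀ j, |(∫ z, lab z.2 * H.rule j z.1 ∂(p : Measure (X × Bool))) - empMean H S j| ≤ lam}

/-- The minimax risk: the least worst-case error probability over the uncertainty set. -/
def minimaxRisk (H : BaseRules X T) (S : Fin n → X × Bool) (lam : ℝ) : ℝ :=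
  ⨅ h : Rule X, ⨆ p : uncertaintySet H S lam,
    risk ((p : ProbabilityMeasure (X × Bool)) : Measure (X × Bool)) h

/-- The objective `F(μ)` of the learning problem `min F(μ)` s.t. `|ħ(x)ᵀ μ| ≤ 1/2` for all `x`. -/
def objective (H : BaseRules X T) (S : Fin n → X × Bool) (lam : ℝ) (μ : Fin T → ℝ) : ℝ :=
  1 / 2 - (1 / (n : ℝ)) * ∑ i, lab (S i).2 * comb H μ (S i).1 + lam * norm1 μ

/-- `μ` is an `ε`-optimal solution of the learning problem: the value suboptimality plus the
expected constraint violation (under the marginal of `p`) is at most `ε`. -/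
def IsOptSolution (H : BaseRules X T) (p : Measure (X × Bool)) (S : Fin n → X × Bool)
    (lam ε : ℝ) (μ : Fin T → ℝ) : Prop :=
  (objective H S lam μ - minimaxRisk H S lam) +
    ∫ x, max (|comb H μ x| - 1 / 2) 0 ∂(p.map Prod.fst) ≤ ε

/-! ### The linear programs of a round -/

/-- Feasibility of `(μ₊, μ₋)` in the primal linear program of the selected base-rules `A`
(coefficients of base-rules that are not selected are zero). -/
def PrimalFeasible (H : BaseRules X T) (S : Fin n → X × Bool) (A : Finset (Fin T))
    (μp μm : Fin T → ℝ) : Prop :=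
  (∀ j, 0 ≤ μp j) ∧ (∀ j, 0 ≤ μm j) ∧ (∀ j, j ∉ A → μp j = 0 ∧ μm j = 0) ∧
    ∀ i, -(1 / 2) ≤ ∑ j ∈ A, H.rule j (S i).1 * (μp j - μm j) ∧
      ∑ j ∈ A, H.rule j (S i).1 * (μp j - μm j) ≤ 1 / 2

/-- The primal objective. -/
def primalValue (H : BaseRules X T) (S : Fin n → X × Bool) (lam : ℝ) (A : Finset (Fin T))
    (μp μm : Fin T → ℝ) : ℝ :=
  1 / 2 - (1 / (n : ℝ)) * ∑ i, lab (S i).2 * ∑ j ∈ A, H.rule j (S i).1 * (μp j - μm j) +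
    lam * ∑ j ∈ A, (μp j + μm j)

/-- `(μ₊, μ₋)` solves the primal linear program. -/
def IsPrimalSolution (H : BaseRules X T) (S : Fin n → X × Bool) (lam : ℝ) (A : Finset (Fin T))
    (μp μm : Fin T → ℝ) : Prop :=
  PrimalFeasible H S A μp μm ∧
    ∀ νp νm, PrimalFeasible H S A νp νm →
      primalValue H S lam A μp μm ≤ primalValue H S lam A νp νm

/-- Feasibility of `(α, β)` in the dual linear program of the selected base-rules `A`. -/
def DualFeasible (H : BaseRules X T) (S : Fin n → X × Bool) (lam : ℝ) (A : Finset (Fin T))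
    (α β : Fin n → ℝ) : Prop :=
  (∀ i, 0 ≤ α i) ∧ (∀ i, 0 ≤ β i) ∧
    ∀ j ∈ A, -lam ≤ ∑ i, H.rule j (S i).1 * (α i - β i - lab (S i).2 / n) ∧
      ∑ i, H.rule j (S i).1 * (α i - β i - lab (S i).2 / n) ≤ lam

/-- The dual objective. -/
def dualValue (α β : Fin n → ℝ) : ℝ := (1 / 2) * (1 - ∑ i, (α i + β i))

/-- `(α, β)` solves the dual linear program. -/
def IsDualSolution (H : BaseRules X T) (S : Fin n → X × Bool) (lam : ℝ) (A : Finset (Fin T))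
    (α β : Fin n → ℝ) : Prop :=
  DualFeasible H S lam A α β ∧
    ∀ α' β', DualFeasible H S lam A α' β' → dualValue α' β' ≤ dualValue α β

/-! ### The column generation algorithm -/

/-- The variables of the algorithm: the selected base-rules, the parameter `μ` (as a vector over
all base-rules, zero outside the ones used in the last linear program), the minimax risk `R`, and
the weights `w` and labels `ytil` of the weighted samples given to the base learner. -/
structure State (T n : ℕ) where
  sel : Finset (Fin T)
  μ : Fin T → ℝ
  R : ℝ
  w : Fin n → ℝ
  ytil : Fin n → ℝ

/-- The initial values. -/
def initState (T : ℕ) (S : Fin n → X × Bool) : State T n where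
  sel := ∅
  μ := 0
  R := 1 / 2
  w := fun _ => 1 / (n : ℝ)
  ytil := fun i => lab (S i).2

/-- The score `∑ i, w_i ỹ_i ħ_j(x_i)` of the base-rule `j`. -/
def score (H : BaseRules X T) (S : Fin n → X × Bool) (w ytil : Fin n → ℝ) (j : Fin T) : ℝ :=
  ∑ i, w i * ytil i * H.rule j (S i).1

/-- The weights obtained from a dual solution. -/
def newW (S : Fin n → X × Bool) (α β : Fin n → ℝ) (i : Fin n) : ℝ :=
  |lab (S i).2 / n - (α i - β i)|

/-- The labels obtained from a dual solution. -/
def newY (S : Fin n → X × Bool) (α β : Fin n → ℝ) (i : Fin n) : ℝ :=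
  Real.sign (lab (S i).2 / n - (α i - β i))

open Classical in
/-- The values at the end of a round whose linear programs, for the selected base-rules `A`, have
the solutions `(μ₊, μ₋)` and `(α, β)`; base-rules with score less than `lam` are removed. -/
def nextState (H : BaseRules X T) (S : Fin n → X × Bool) (lam : ℝ) (A : Finset (Fin T))
    (μp μm : Fin T → ℝ) (α β : Fin n → ℝ) : State T n where
  sel := A.filter fun j => ¬ score H S (newW S α β) (newY S α β) j < lam
  μ := μp - μm
  R := primalValue H S lam A μp μm
  w := newW S α β
  ytil := newY S α β

/-- `Reaches H S lam k s`: some run of the algorithm on the sample `S` (for some choices of the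
base learner and of the solutions of the linear programs) completes the rounds `1, …, k` without
stopping, and `s` holds the values at the end of round `k`. -/
inductive Reaches (H : BaseRules X T) (S : Fin n → X × Bool) (lam : ℝ) : ℕ → State T n → Prop
  | init : Reaches H S lam 0 (initState T S)
  | round (k : ℕ) (s : State T n) (j : Fin T) (μp μm : Fin T → ℝ) (α β : Fin n → ℝ) :
      Reaches H S lam k s →
      lam < score H S s.w s.ytil j →
      IsPrimalSolution H S lam (insert j s.sel) μp μm →
      IsDualSolution H S lam (insert j s.sel) α β →
      Reaches H S lam (k + 1) (nextState H S lam (insert j s.sel) μp μm α β)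

/-- `StopsAt H S lam k j s`: some run of the algorithm stops at round `k` by the stopping test,
because the base-rule `j` returned by the base learner at that round has score at most `lam`;
`s` holds the values at that moment (those of the end of the previous round). -/
def StopsAt (H : BaseRules X T) (S : Fin n → X × Bool) (lam : ℝ) (k : ℕ) (j : Fin T)
    (s : State T n) : Prop :=
  ∃ k', k = k' + 1 ∧ Reaches H S lam k' s ∧ score H S s.w s.ytil j ≤ lam

/-- The base learner solves its problem exactly when it returns `j` at the values `s`. -/
def IsExactChoice (H : BaseRules X T) (S : Fin n → X × Bool) (s : State T n) (j : Fin T) :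
    Prop :=
  ∀ j', score H S s.w s.ytil j' ≤ score H S s.w s.ytil j

/-! ### Complexity of the base-rules -/

/-- A finite set of pairs `(x, t)` is shattered by the base-rules if each of its subsets is cut out
by the subgraph `{(x, t) | t < ħ(x)}` of some base-rule `ħ`. -/
def SubgraphShatters (H : BaseRules X T) (s : Finset (X × ℝ)) : Prop :=
  ∀ A ⊆ s, ∃ j, ∀ z ∈ s, z ∈ A ↔ z.2 < H.rule j z.1

/-- The VC-dimension of the (real-valued) base-rules, i.e. the VC-dimension of their subgraphs.
For base-rules with values in `{-1, 1}` it is the VC-dimension of the family of classifiers. -/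
def vcDim (H : BaseRules X T) : ℕ :=
  sSup {d | ∃ s : Finset (X × ℝ), s.card = d ∧ SubgraphShatters H s}

/-- The term `ε(δ)` for `n` samples, VC-dimension `D` and `C = ‖μ‖₁`. -/
def epsDelta (n D : ℕ) (δ C : ℝ) : ℝ :=
  if C ≤ 1 / 2 then 0
  else 2 * C * √(2 * D * Real.log (3 * n / D) / n) +
    (C - 1 / 2) * √(Real.log (1 / δ) / (2 * n))

end RMBoost

end

/-!
The random part of the statement is confined to one event, on which everything else is
deterministic: for every `μ` with `|ħ(x_i)ᵀ μ| ≤ 1/2` at all sample points, the expected violation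
`E (|ħ(x)ᵀ μ| - 1/2)₊` is at most `ε(δ)` (`measure_epsDelta_lt_violation_le`). The vectors `μ`
produced by the algorithm satisfy these constraints.

*The error probability.* Clipping costs at most the violation, so `R(h_μ)` is at most `1/2 - E y
ħ(x)ᵀ μ` plus the expected violation. Label noise changes the expectation of `y ħ(x)ᵀ μ` by at
most `2 P_noise ‖μ‖₁`, replacing it by the training average costs `ε_est ‖μ‖₁`, and what remains
is the objective of the linear program (`risk_ruleOf_le_objective`).

*Optimality.* If no base-rule has score above `λ`, the dual solution of the last linear program is
feasible for the dual with all base-rules, so by strong duality `R` is the value of the latter.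
Strong duality holds for the linear program with constraints at the sample points only
(`exists_dualFeasible`, from the Hahn-Banach theorem). A dual feasible `(α, β)` defines a
distribution on the sample points that lies in the uncertainty set and on which every rule has an
error of at least the dual value; hence the dual value is at most the minimax risk
(`dualValue_le_minimaxRisk`).

*Uniform deviations.* Scaling `μ` to norm one turns the constraint level `1/2` into `θ = 1 / (2
‖μ‖₁)`, so the claim concerns the functions `(|ħ(x)ᵀ ν| - θ)₊` with `‖ν‖₁ ≤ 1`, for all `θ` at
once, which vanish on the sample. For a fixed `θ` they have range `[0, 1 - θ]`, and McDiarmid's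
inequality (`measureReal_pi_le_of_bounded_differences`) bounds their largest deviation in terms of
its expectation. This range is the reason for the factor `‖μ‖₁ - 1/2` in `ε(δ)`. The expectation
is bounded through its exponential moment: symmetrization with a sample of twice the size
(`exp_integral_iSup_le_of_rademacher`), the contraction principle for `r ↦ (|r| - θ)₊`, and the
reduction of the base-rules to their subgraphs at a random threshold, of which there are few by
the Sauer-Shelah lemma (`sum_exp_iSup_violation_le`). Working with `2 n` signs gains a factor `√2`
over the usual symmetrization. With `g = 2 √(2 D log (3 n / D) / n)` and `L = log (3 n / D)`, the
bound is `meanRatio L * g` with `meanRatio L` below `0.95` when `g < 1` (otherwise there is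
nothing to prove). The slack in `g` pays for a union bound over a grid of levels `θ` of mesh `g /
20`: the grid has at most `exp (0.81 L - 2.09)` points (`grid_card_le_exp`), and each of them
fails with probability at most `δ exp (-(0.81 L - 2.09))` (`exponent_ge`, `measure_deviation_le`).
-/

namespace RMBoost

variable {X : Type*} [MeasurableSpace X] {T n : ℕ}

/-! ### Elementary facts on labels and combinations of base-rules -/

theorem abs_lab (y : Bool) : |lab y| = 1 := by cases y <;> simp [lab]

theorem abs_lab_le (y : Bool) : |lab y| ≤ 1 := (abs_lab y).le

theorem measurable_lab : Measurable lab := measurable_from_top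

theorem norm1_nonneg (μ : Fin T → ℝ) : 0 ≤ norm1 μ := Finset.sum_nonneg fun _ _ => abs_nonneg _

theorem norm1_smul (a : ℝ) (μ : Fin T → ℝ) : norm1 (a • μ) = |a| * norm1 μ := by
  simp [norm1, abs_mul, Finset.mul_sum]

theorem comb_smul (H : BaseRules X T) (a : ℝ) (μ : Fin T → ℝ) (x : X) :
    comb H (a • μ) x = a * comb H μ x := by
  simp only [comb, Pi.smul_apply, smul_eq_mul, Finset.mul_sum]
  exact Finset.sum_congr rfl fun j _ => by ring

theorem comb_zero (H : BaseRules X T) (x : X) : comb H 0 x = 0 := by simp [comb]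

theorem abs_comb_sub_le (H : BaseRules X T) (μ ν : Fin T → ℝ) (x : X) :
    |comb H μ x - comb H ν x| ≤ norm1 (μ - ν) := by
  simp only [comb, norm1, ← Finset.sum_sub_distrib, ← mul_sub]
  refine (Finset.abs_sum_le_sum_abs _ _).trans (Finset.sum_le_sum fun j _ => ?_)
  rw [abs_mul, Pi.sub_apply]
  exact mul_le_of_le_one_left (abs_nonneg _) (H.abs_rule_le j x)

theorem abs_comb_le (H : BaseRules X T) (μ : Fin T → ℝ) (x : X) : |comb H μ x| ≤ norm1 μ := by
  simpa [comb_zero] using abs_comb_sub_le H μ 0 x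

/-- The training average of `y ħ(x)ᵀ μ` in terms of the training averages of the base-rules. -/
theorem sum_lab_mul_comb (H : BaseRules X T) (S : Fin n → X × Bool) (μ : Fin T → ℝ) :
    (1 / (n : ℝ)) * ∑ i, lab (S i).2 * comb H μ (S i).1 = ∑ j, μ j * empMean H S j := by
  simp only [comb, empMean, Finset.mul_sum]
  rw [Finset.sum_comm]
  exact Finset.sum_congr rfl fun j _ => Finset.sum_congr rfl fun i _ => by ring

/-! ### Strong duality of the linear programs -/

/-- The values on the training instances of the combination of the selected base-rules. -/
noncomputable def sampleComb (H : BaseRules X T) (S : Fin n → X × Bool) (A : Finset (Fin T)) :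
    (Fin T → ℝ) →ₗ[ℝ] (Fin n → ℝ) where
  toFun u i := ∑ j ∈ A, H.rule j (S i).1 * u j
  map_add' u v := by
    funext i
    simp [mul_add, Finset.sum_add_distrib]
  map_smul' a u := by
    funext i
    simp only [Pi.smul_apply, smul_eq_mul, RingHom.id_apply, Finset.mul_sum]
    exact Finset.sum_congr rfl fun j _ => by ring

/-- The average over the training samples of the products of labels and given values. -/
noncomputable def labelAvg (S : Fin n → X × Bool) : (Fin n → ℝ) →ₗ[ℝ] ℝ where
  toFun w := (1 / (n : ℝ)) * ∑ i, lab (S i).2 * w i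
  map_add' u v := by simp [mul_add, Finset.sum_add_distrib]
  map_smul' a u := by
    simp only [Pi.smul_apply, smul_eq_mul, RingHom.id_apply, Finset.mul_sum]
    exact Finset.sum_congr rfl fun j _ => by ring

/-- Optimality of the primal solution, homogenized: the linear part of the objective is dominated
by a sublinear functional. -/
theorem labelAvg_sampleComb_le {H : BaseRules X T} {S : Fin n → X × Bool} {lam : ℝ}
    (hlam : 0 ≤ lam) {A : Finset (Fin T)} {μp μm : Fin T → ℝ}
    (hsol : IsPrimalSolution H S lam A μp μm) (u : Fin T → ℝ) :
    labelAvg S (sampleComb H S A u) ≤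
      lam * norm1 u + 2 * (1 / 2 - primalValue H S lam A μp μm) * ‖sampleComb H S A u‖ := by
  have key : ∀ u : Fin T → ℝ, ‖sampleComb H S A u‖ ≤ 1 / 2 →
      labelAvg S (sampleComb H S A u) ≤
        lam * norm1 u + (1 / 2 - primalValue H S lam A μp μm) := by
    intro u hu
    classical
    have hd : ∀ i, ∑ j ∈ A, H.rule j (S i).1 *
        ((if j ∈ A then max (u j) 0 else 0) - (if j ∈ A then max (-u j) 0 else 0)) =
          sampleComb H S A u i := fun i => by
      refine Finset.sum_congr rfl fun j hj => ?_
      rw [if_pos hj, if_pos hj, max_zero_sub_max_neg_zero_eq_self]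
    have h := hsol.2 (fun j => if j ∈ A then max (u j) 0 else 0)
      (fun j => if j ∈ A then max (-u j) 0 else 0) ⟨fun j => ?_, fun j => ?_, fun j hj => ?_,
        fun i => ?_⟩
    · have hs : ∑ j ∈ A, ((if j ∈ A then max (u j) 0 else 0) +
          (if j ∈ A then max (-u j) 0 else 0)) ≤ norm1 u := by
        rw [norm1]
        refine (Finset.sum_le_sum (g := fun j => |u j|) fun j hj => ?_).trans
          (Finset.sum_le_univ_sum_of_nonneg fun _ => abs_nonneg _)
        rw [if_pos hj, if_pos hj, max_zero_add_max_neg_zero_eq_abs_self]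
      have hs' := mul_le_mul_of_nonneg_left hs hlam
      have hv : labelAvg S (sampleComb H S A u) =
        (1 / (n : ℝ)) * ∑ i, lab (S i).2 * sampleComb H S A u i := rfl
      rw [primalValue.eq_1 H S lam A (fun j => if j ∈ A then max (u j) 0 else 0)] at h
      simp only [hd] at h
      linarith
    · dsimp only
      split_ifs <;> simp
    · dsimp only
      split_ifs <;> simp
    · simp [hj]
    · simp only [hd]
      have := (norm_le_pi_norm (sampleComb H S A u) i).trans hu
      rw [Real.norm_eq_abs] at this
      exact abs_le.1 this
  rcases (norm_nonneg (sampleComb H S A u)).eq_or_lt with h0 | h0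
  · rw [← h0, norm_eq_zero.1 h0.symm, map_zero]
    have := mul_nonneg hlam (norm1_nonneg u)
    linarith
  · set r := ‖sampleComb H S A u‖
    have h := key ((1 / (2 * r)) • u) (by
      rw [map_smul, norm_smul, Real.norm_eq_abs, abs_of_pos (by positivity)]
      change 1 / (2 * r) * r ≤ 1 / 2
      field_simp
      exact le_rfl)
    rw [map_smul, map_smul, norm1_smul, abs_of_pos (by positivity), smul_eq_mul] at h
    have h' := mul_le_mul_of_nonneg_left h (by positivity : 0 ≤ 2 * r)
    have e1 : 2 * r * (1 / (2 * r) * labelAvg S (sampleComb H S A u)) =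
        labelAvg S (sampleComb H S A u) := by field_simp
    have e2 : 2 * r * (lam * (1 / (2 * r) * norm1 u) +
        (1 / 2 - primalValue H S lam A μp μm)) =
        lam * norm1 u + 2 * (1 / 2 - primalValue H S lam A μp μm) * r := by field_simp
    linarith

/-- Strong duality, from the Hahn-Banach theorem: the functional `labelAvg` on the graph of
`sampleComb` extends to a functional dominated by the same sublinear functional, and its
coefficients on the sample are the differences `α - β`. -/
theorem exists_dualFeasible {H : BaseRules X T} {S : Fin n → X × Bool} {lam : ℝ}
    (hlam : 0 ≤ lam) {A : Finset (Fin T)} {μp μm : Fin T → ℝ}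
    (hsol : IsPrimalSolution H S lam A μp μm) :
    ∃ α β, DualFeasible H S lam A α β ∧ primalValue H S lam A μp μm ≤ dualValue α β := by
  classical
  set V := 1 / 2 - primalValue H S lam A μp μm with hV
  have hV0 : 0 ≤ V := by
    have h := hsol.2 0 0 ⟨fun _ => le_rfl, fun _ => le_rfl, fun _ _ => ⟨rfl, rfl⟩,
      fun i => by simp⟩
    have e : primalValue H S lam A 0 0 = 1 / 2 := by simp [primalValue]
    rw [e] at h
    linarith
  obtain ⟨g, hg, hgN⟩ := exists_extension_of_le_sublinear
    (E := (Fin T → ℝ) × (Fin n → ℝ))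
    ⟨(sampleComb H S A).graph, ((labelAvg S).comp (LinearMap.snd ℝ _ _)).domRestrict _⟩
    (fun x => lam * norm1 x.1 + 2 * V * ‖x.2‖)
    (fun c hc x => by
      simp only [Prod.smul_fst, Prod.smul_snd, norm1_smul, norm_smul, Real.norm_eq_abs,
        abs_of_pos hc]
      ring)
    (fun x y => by
      have h1 : norm1 (x.1 + y.1) ≤ norm1 x.1 + norm1 y.1 := by
        simp only [norm1, ← Finset.sum_add_distrib]
        exact Finset.sum_le_sum fun j _ => abs_add_le _ _
      have h2 := norm_add_le x.2 y.2
      have h1' := mul_le_mul_of_nonneg_left h1 hlam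
      have h2' := mul_le_mul_of_nonneg_left h2 (by positivity : 0 ≤ 2 * V)
      simp only [Prod.fst_add, Prod.snd_add]
      linarith)
    (fun x => by
      obtain ⟨⟨u, w⟩, hx⟩ := x
      have hw : w = sampleComb H S A u := hx
      subst hw
      exact labelAvg_sampleComb_le hlam hsol u)
  set d : Fin n → ℝ := fun i => g (0, fun k => if i = k then 1 else 0) with hd
  have hgd : ∀ w : Fin n → ℝ, g (0, w) = ∑ i, w i * d i := fun w => by
    have := LinearMap.pi_apply_eq_sum_univ (g.comp (LinearMap.inr ℝ (Fin T → ℝ) (Fin n → ℝ))) w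
    simpa [hd] using this
  refine ⟨fun i => max (d i) 0, fun i => max (-d i) 0,
    ⟨fun i => le_max_right _ _, fun i => le_max_right _ _, fun j hj => ?_⟩, ?_⟩
  · have e1 : sampleComb H S A (Pi.single j 1) = fun i => H.rule j (S i).1 := by
      funext i
      simp [sampleComb, Pi.single_apply, hj]
    have e2 : g (Pi.single j 1, sampleComb H S A (Pi.single j 1)) =
        labelAvg S (sampleComb H S A (Pi.single j 1)) :=
      hg ⟨(Pi.single j 1, sampleComb H S A (Pi.single j 1)), rfl⟩
    have e3 : g (Pi.single j 1, sampleComb H S A (Pi.single j 1)) =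
        g (Pi.single j 1, 0) + g (0, sampleComb H S A (Pi.single j 1)) := by
      rw [← map_add, Prod.mk_add_mk, add_zero, zero_add]
    rw [e3, hgd] at e2
    simp only [e1] at e2
    change _ = (1 / (n : ℝ)) * ∑ i, lab (S i).2 * H.rule j (S i).1 at e2
    have e4 : ∑ i, H.rule j (S i).1 * (max (d i) 0 - max (-d i) 0 - lab (S i).2 / n) =
        -g (Pi.single j 1, 0) := by
      have e : ∀ i, H.rule j (S i).1 * (max (d i) 0 - max (-d i) 0 - lab (S i).2 / n) =
          H.rule j (S i).1 * d i - 1 / (n : ℝ) * (lab (S i).2 * H.rule j (S i).1) := fun i => by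
        rw [max_zero_sub_max_neg_zero_eq_self]
        ring
      simp_rw [e]
      rw [Finset.sum_sub_distrib, ← Finset.mul_sum]
      linarith
    have hn1 : norm1 (Pi.single j 1 : Fin T → ℝ) = 1 := by
      simp [norm1, Pi.single_apply, apply_ite abs]
    have b1 := hgN (Pi.single j 1, 0)
    have b2 := hgN (-Pi.single j 1, 0)
    have e5 : g (-Pi.single j 1, 0) = -g (Pi.single j 1, 0) := by
      rw [← map_neg, Prod.neg_mk, neg_zero]
    have hn2 : norm1 (-Pi.single j 1 : Fin T → ℝ) = 1 := by
      simp [norm1, Pi.single_apply, apply_ite abs]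
    rw [e5] at b2
    simp only [hn1, hn2, norm_zero, mul_zero, add_zero, mul_one] at b1 b2
    rw [e4]
    constructor <;> linarith
  · have b := hgN (0, fun i => SignType.sign (d i))
    rw [hgd] at b
    have e1 : ∑ i, (SignType.sign (d i) : ℝ) * d i = ∑ i, |d i| :=
      Finset.sum_congr rfl fun i _ => sign_mul_self _
    have e2 : ‖fun i => (SignType.sign (d i) : ℝ)‖ ≤ 1 := by
      refine (pi_norm_le_iff_of_nonneg zero_le_one).2 fun i => ?_
      rcases lt_trichotomy (d i) 0 with h | h | h <;> simp [h]
    have e3 : ∑ i, (max (d i) 0 + max (-d i) 0) = ∑ i, |d i| :=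
      Finset.sum_congr rfl fun i _ => by
        rw [max_zero_add_max_neg_zero_eq_abs_self]
    have e4 : norm1 (0 : Fin T → ℝ) = 0 := by simp [norm1]
    have b' := mul_le_mul_of_nonneg_left e2 (by positivity : 0 ≤ 2 * V)
    simp only [e1, e4] at b
    rw [dualValue, e3]
    linarith

/-! ### A lower bound for the minimax risk -/

/-- The distribution on the training instances that gives the pairs `(x_i, +1)` and `(x_i, -1)` the
masses `a i` and `b i`. -/
noncomputable def sampleMeasure (S : Fin n → X × Bool) (a b : Fin n → ℝ) : Measure (X × Bool) :=
  ∑ i, (ENNReal.ofReal (a i) • Measure.dirac ((S i).1, true) +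
    ENNReal.ofReal (b i) • Measure.dirac ((S i).1, false))

theorem integral_sampleMeasure (S : Fin n → X × Bool) {a b : Fin n → ℝ} (ha : ∀ i, 0 ≤ a i)
    (hb : ∀ i, 0 ≤ b i) {F : X × Bool → ℝ} (hF : Measurable F) :
    ∫ z, F z ∂(sampleMeasure S a b) =
      ∑ i, (a i * F ((S i).1, true) + b i * F ((S i).1, false)) := by
  have hi : ∀ z (r : ℝ), Integrable F (ENNReal.ofReal r • Measure.dirac z) := fun z r =>
    (integrable_dirac' hF.stronglyMeasurable (by simp)).smul_measure ENNReal.ofReal_ne_top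
  rw [sampleMeasure, integral_finsetSum_measure fun i _ => (hi _ _).add_measure (hi _ _)]
  refine Finset.sum_congr rfl fun i _ => ?_
  rw [integral_add_measure (hi _ _) (hi _ _), integral_smul_measure, integral_smul_measure,
    integral_dirac' _ _ hF.stronglyMeasurable, integral_dirac' _ _ hF.stronglyMeasurable,
    ENNReal.toReal_ofReal (ha i), ENNReal.toReal_ofReal (hb i)]
  simp

theorem sampleMeasure_univ (S : Fin n → X × Bool) {a b : Fin n → ℝ} (ha : ∀ i, 0 ≤ a i)
    (hb : ∀ i, 0 ≤ b i) (h : ∑ i, (a i + b i) = 1) : sampleMeasure S a b Set.univ = 1 := by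
  simp only [sampleMeasure, Measure.coe_finsetSum, Finset.sum_apply, Measure.add_apply,
    Measure.smul_apply, measure_univ, smul_eq_mul, mul_one]
  simp_rw [← ENNReal.ofReal_add (ha _) (hb _)]
  rw [← ENNReal.ofReal_sum_of_nonneg fun i _ => add_nonneg (ha i) (hb i), h, ENNReal.ofReal_one]

theorem Rule.prob_le_one (h : Rule X) (y : Bool) (x : X) : h.prob y x ≤ 1 := by
  have h1 := h.prob_add x
  have h2 := h.prob_nonneg true x
  have h3 := h.prob_nonneg false x
  cases y <;> linarith

theorem Rule.measurable_uncurry_prob (h : Rule X) :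
    Measurable fun z : X × Bool => h.prob z.2 z.1 :=
  measurable_from_prod_countable_left h.measurable_prob

theorem risk_le_one (p : Measure (X × Bool)) [IsProbabilityMeasure p] (h : Rule X) :
    risk p h ≤ 1 := by
  have hi : Integrable (fun z : X × Bool => 1 - h.prob z.2 z.1) p :=
    Integrable.of_bound (measurable_const.sub h.measurable_uncurry_prob).aestronglyMeasurable 1
      (ae_of_all _ fun z => by
        rw [Real.norm_eq_abs, abs_le]
        constructor <;> linarith [h.prob_nonneg z.2 z.1, h.prob_le_one z.2 z.1])
  refine (integral_mono hi (integrable_const 1) fun z => ?_).trans (by simp)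
  linarith [h.prob_nonneg z.2 z.1]

/-- A pair `(α, β)` that satisfies the dual constraints for all base-rules gives an adversarial
distribution in the uncertainty set: the mass `1 - ∑ (α + β)` that is left is split evenly over the
two labels, so that no rule has a risk below the dual value. -/
theorem dualValue_le_minimaxRisk (H : BaseRules X T) (S : Fin n → X × Bool) (hn : 1 ≤ n) {lam : ℝ}
    {α β : Fin n → ℝ} (hf : DualFeasible H S lam Finset.univ α β) (hV : 0 ≤ dualValue α β) :
    dualValue α β ≤ minimaxRisk H S lam := by
  set V := dualValue α β with hVdef
  have hn0 : (0 : ℝ) < n := by exact_mod_cast hn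
  have ha : ∀ i, 0 ≤ α i + V / n := fun i => add_nonneg (hf.1 i) (by positivity)
  have hb : ∀ i, 0 ≤ β i + V / n := fun i => add_nonneg (hf.2.1 i) (by positivity)
  have hsum : ∑ i, ((α i + V / n) + (β i + V / n)) = 1 := by
    have e : ∀ i, (α i + V / n) + (β i + V / n) = (α i + β i) + 2 * V / n := fun i => by ring
    simp_rw [e]
    rw [Finset.sum_add_distrib, Finset.sum_const, Finset.card_univ, Fintype.card_fin, nsmul_eq_mul,
      mul_div_cancel₀ _ hn0.ne', hVdef, dualValue]
    ring
  set q := sampleMeasure S (fun i => α i + V / n) (fun i => β i + V / n) with hq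
  have hprob : IsProbabilityMeasure q := ⟨sampleMeasure_univ S ha hb hsum⟩
  have hmem : (⟨q, hprob⟩ : ProbabilityMeasure (X × Bool)) ∈ uncertaintySet H S lam := fun j => by
    have hm : Measurable fun z : X × Bool => lab z.2 * H.rule j z.1 :=
      (measurable_lab.comp measurable_snd).mul ((H.measurable_rule j).comp measurable_fst)
    change |(∫ z, lab z.2 * H.rule j z.1 ∂q) - empMean H S j| ≤ lam
    rw [hq, integral_sampleMeasure S ha hb hm, empMean, Finset.mul_sum, ← Finset.sum_sub_distrib,
      abs_le]
    have e : ∀ i, (α i + V / n) * (lab true * H.rule j (S i).1) +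
        (β i + V / n) * (lab false * H.rule j (S i).1) -
          1 / (n : ℝ) * (lab (S i).2 * H.rule j (S i).1) =
        H.rule j (S i).1 * (α i - β i - lab (S i).2 / n) := fun i => by
      simp only [lab, if_true, Bool.false_eq_true, if_false]
      ring
    simp_rw [e]
    exact hf.2.2 j (Finset.mem_univ j)
  have : Nonempty (Rule X) := ⟨ruleOf H 0⟩
  refine le_ciInf fun h => ?_
  have hle : V ≤ risk q h := by
    have hm : Measurable fun z : X × Bool => 1 - h.prob z.2 z.1 :=
      measurable_const.sub h.measurable_uncurry_prob
    rw [risk, hq, integral_sampleMeasure S ha hb hm]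
    have e : ∑ _i : Fin n, V / n = V := by
      rw [Finset.sum_const, Finset.card_univ, Fintype.card_fin, nsmul_eq_mul,
        mul_div_cancel₀ _ hn0.ne']
    refine e.symm.le.trans ?_
    refine Finset.sum_le_sum fun i _ => ?_
    have h1 := h.prob_add (S i).1
    have h2 := mul_nonneg (hf.1 i) (h.prob_nonneg false (S i).1)
    have h3 := mul_nonneg (hf.2.1 i) (h.prob_nonneg true (S i).1)
    have h4 : h.prob true (S i).1 = 1 - h.prob false (S i).1 := by linarith
    dsimp only
    rw [h4] at h3 ⊢
    nlinarith
  refine hle.trans (le_ciSup (f := fun p : uncertaintySet H S lam =>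
    risk ((p : ProbabilityMeasure (X × Bool)) : Measure (X × Bool)) h) ⟨1, ?_⟩ ⟨⟨q, hprob⟩, hmem⟩)
  rintro _ ⟨p, rfl⟩
  exact risk_le_one _ h

/-! ### Properties of the states reached by the algorithm -/

theorem comb_eq_of_primalFeasible {H : BaseRules X T} {S : Fin n → X × Bool} {A : Finset (Fin T)}
    {μp μm : Fin T → ℝ} (hf : PrimalFeasible H S A μp μm) (x : X) :
    ∑ j ∈ A, H.rule j x * (μp j - μm j) = comb H (μp - μm) x := by
  refine Finset.sum_subset (Finset.subset_univ A) fun j _ hj => ?_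
  rw [(hf.2.2.1 j hj).1, (hf.2.2.1 j hj).2, sub_zero, mul_zero]

theorem objective_le_primalValue {H : BaseRules X T} {S : Fin n → X × Bool} {lam : ℝ}
    (hlam : 0 ≤ lam) {A : Finset (Fin T)} {μp μm : Fin T → ℝ}
    (hf : PrimalFeasible H S A μp μm) :
    objective H S lam (μp - μm) ≤ primalValue H S lam A μp μm := by
  simp only [objective, primalValue, comb_eq_of_primalFeasible hf]
  gcongr
  rw [norm1, ← Finset.sum_subset (Finset.subset_univ A) fun j _ hj => by
    rw [Pi.sub_apply, (hf.2.2.1 j hj).1, (hf.2.2.1 j hj).2, sub_zero, abs_zero]]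
  refine Finset.sum_le_sum fun j _ => ?_
  rw [Pi.sub_apply, abs_le]
  constructor <;> linarith [hf.1 j, hf.2.1 j]

theorem objective_zero (H : BaseRules X T) (S : Fin n → X × Bool) (lam : ℝ) :
    objective H S lam 0 = 1 / 2 := by simp [objective, comb_zero, norm1]

theorem Reaches.abs_comb_le {H : BaseRules X T} {S : Fin n → X × Bool} {lam : ℝ} {k : ℕ}
    {s : State T n} (h : Reaches H S lam k s) (i : Fin n) : |comb H s.μ (S i).1| ≤ 1 / 2 := by
  cases h with
  | init => simp [initState, comb_zero]
  | round k s j μp μm α β _ _ hp _ =>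
    have := hp.1.2.2.2 i
    rw [comb_eq_of_primalFeasible hp.1] at this
    exact abs_le.2 this

theorem Reaches.objective_le {H : BaseRules X T} {S : Fin n → X × Bool} {lam : ℝ}
    (hlam : 0 ≤ lam) {k : ℕ} {s : State T n} (h : Reaches H S lam k s) :
    objective H S lam s.μ ≤ s.R := by
  cases h with
  | init => exact (objective_zero H S lam).le
  | round k s j μp μm α β _ _ hp _ => exact objective_le_primalValue hlam hp.1

/-- As the base-rules are closed under negation, upper bounds for the scores are bounds for their
absolute values, i.e. the dual constraints of all base-rules. -/
theorem dualFeasible_univ {H : BaseRules X T} {S : Fin n → X × Bool} {lam : ℝ} {α β : Fin n → ℝ}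
    (hα : ∀ i, 0 ≤ α i) (hβ : ∀ i, 0 ≤ β i)
    (hs : ∀ j, ∑ i, (lab (S i).2 / n - (α i - β i)) * H.rule j (S i).1 ≤ lam) :
    DualFeasible H S lam Finset.univ α β := by
  refine ⟨hα, hβ, fun j _ => ?_⟩
  have e : ∑ i, H.rule j (S i).1 * (α i - β i - lab (S i).2 / n) =
      -∑ i, (lab (S i).2 / n - (α i - β i)) * H.rule j (S i).1 := by
    rw [← Finset.sum_neg_distrib]
    exact Finset.sum_congr rfl fun i _ => by ring
  obtain ⟨j', hj'⟩ := H.exists_neg j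
  have h1 := hs j
  have h2 := hs j'
  simp_rw [hj', mul_neg] at h2
  rw [Finset.sum_neg_distrib] at h2
  rw [e]
  constructor <;> linarith

/-- If no base-rule has a score above `lam`, the current parameter attains at most the minimax
risk. -/
theorem Reaches.objective_le_minimaxRisk {H : BaseRules X T} {S : Fin n → X × Bool} {lam : ℝ}
    (hlam : 0 ≤ lam) (hn : 1 ≤ n) {k : ℕ} {s : State T n} (h : Reaches H S lam k s)
    (hs : ∀ j, score H S s.w s.ytil j ≤ lam) :
    objective H S lam s.μ ≤ minimaxRisk H S lam := by
  cases h with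
  | init =>
    have hf : DualFeasible H S lam Finset.univ 0 0 :=
      dualFeasible_univ (fun _ => le_rfl) (fun _ => le_rfl) fun j => by
        convert hs j using 1
        refine Finset.sum_congr rfl fun i _ => ?_
        simp only [initState, Pi.zero_apply]
        ring
    have e : dualValue (0 : Fin n → ℝ) 0 = 1 / 2 := by simp [dualValue]
    have := dualValue_le_minimaxRisk H S hn hf (by rw [e]; norm_num)
    rw [e] at this
    exact (objective_zero H S lam).le.trans this
  | round k s j μp μm α β _ _ hp hd =>
    obtain ⟨α', β', hf', hle⟩ := exists_dualFeasible hlam hp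
    have hle' := hle.trans (hd.2 α' β' hf')
    have hf : DualFeasible H S lam Finset.univ α β := dualFeasible_univ hd.1.1 hd.1.2.1 fun j => by
      convert hs j using 1
      refine Finset.sum_congr rfl fun i _ => ?_
      simp only [nextState, newW, newY]
      rcases lt_trichotomy (lab (S i).2 / n - (α i - β i)) 0 with h | h | h
      · rw [abs_of_neg h, Real.sign_of_neg h]
        ring
      · rw [h]
        simp
      · rw [abs_of_pos h, Real.sign_of_pos h, mul_one]
    have h0 : 0 ≤ primalValue H S lam (insert j s.sel) μp μm := by
      have h1 : (1 / (n : ℝ)) * ∑ i, lab (S i).2 *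
          ∑ j ∈ insert j s.sel, H.rule j (S i).1 * (μp j - μm j) ≤ 1 / 2 := by
        have hn0 : (0 : ℝ) < n := by exact_mod_cast hn
        have h2 : ∑ i, lab (S i).2 * ∑ j ∈ insert j s.sel, H.rule j (S i).1 * (μp j - μm j) ≤
            ∑ _i : Fin n, 1 / 2 := Finset.sum_le_sum fun i _ => by
          refine (le_abs_self _).trans ?_
          rw [abs_mul, abs_lab, one_mul]
          exact abs_le.2 (hp.1.2.2.2 i)
        rw [Finset.sum_const, Finset.card_univ, Fintype.card_fin, nsmul_eq_mul] at h2
        rw [one_div_mul_eq_div, div_le_iff₀ hn0]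
        linarith
      have h3 : 0 ≤ lam * ∑ j ∈ insert j s.sel, (μp j + μm j) :=
        mul_nonneg hlam (Finset.sum_nonneg fun j _ => add_nonneg (hp.1.1 j) (hp.1.2.1 j))
      rw [primalValue]
      linarith
    exact (objective_le_primalValue hlam hp.1).trans (hle'.trans
      (dualValue_le_minimaxRisk H S hn hf (h0.trans hle')))

end RMBoost

namespace RMBoost

variable {X : Type*} [MeasurableSpace X] {T n : ℕ}

/-! ### The distribution of the training samples and the error probability -/

theorem measurable_uncurry_bool {ρ : Bool → X → ℝ} (hρ : ∀ y, Measurable (ρ y)) :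
    Measurable fun z : X × Bool => ρ z.2 z.1 :=
  measurable_from_prod_countable_left hρ

theorem measurable_flip : Measurable fun z : X × Bool => (z.1, !z.2) :=
  measurable_fst.prodMk ((measurable_from_top (f := not)).comp measurable_snd)

theorem isProbabilityMeasure_trainDist (p : Measure (X × Bool)) [IsProbabilityMeasure p]
    {ρ : Bool → X → ℝ} (hρ : ∀ y, Measurable (ρ y)) (h0 : ∀ y x, 0 ≤ ρ y x)
    (h1 : ∀ y x, ρ y x ≤ 1) : IsProbabilityMeasure (trainDist p ρ) := by
  refine ⟨?_⟩
  have hm := measurable_uncurry_bool hρ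
  rw [trainDist, Measure.add_apply, Measure.map_apply measurable_flip MeasurableSet.univ,
    Set.preimage_univ, withDensity_apply _ MeasurableSet.univ,
    withDensity_apply _ MeasurableSet.univ, Measure.restrict_univ,
    ← lintegral_add_right _ hm.ennreal_ofReal]
  simp_rw [← ENNReal.ofReal_add (sub_nonneg.2 (h1 _ _)) (h0 _ _), sub_add_cancel]
  simp

theorem integral_trainDist (p : Measure (X × Bool)) [IsProbabilityMeasure p]
    {ρ : Bool → X → ℝ} (hρ : ∀ y, Measurable (ρ y)) (h0 : ∀ y x, 0 ≤ ρ y x)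
    (h1 : ∀ y x, ρ y x ≤ 1) {F : X × Bool → ℝ} (hF : Measurable F) {C : ℝ}
    (hC : ∀ z, |F z| ≤ C) :
    ∫ z, F z ∂(trainDist p ρ) =
      ∫ z, ((1 - ρ z.2 z.1) * F z + ρ z.2 z.1 * F (z.1, !z.2)) ∂p := by
  have hm := measurable_uncurry_bool hρ
  have hm' : Measurable fun z : X × Bool => 1 - ρ z.2 z.1 := measurable_const.sub hm
  have hprob := isProbabilityMeasure_trainDist p hρ h0 h1
  have hi : Integrable F (trainDist p ρ) :=
    Integrable.of_bound hF.aestronglyMeasurable C (ae_of_all _ hC)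
  have hF' := hF.comp measurable_flip
  have b : ∀ z : X × Bool, ∀ w : ℝ, 0 ≤ w → w ≤ 1 → ∀ z', ‖w * F z'‖ ≤ C := fun z w hw hw' z' => by
    rw [Real.norm_eq_abs, abs_mul, abs_of_nonneg hw]
    exact (mul_le_of_le_one_left (abs_nonneg _) hw').trans (hC z')
  rw [trainDist] at hi ⊢
  rw [integral_add_measure hi.left_of_add_measure hi.right_of_add_measure,
    integral_map measurable_flip.aemeasurable hF.aestronglyMeasurable,
    integral_withDensity_eq_integral_toReal_smul hm'.ennreal_ofReal (by simp),
    integral_withDensity_eq_integral_toReal_smul hm.ennreal_ofReal (by simp), integral_add]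
  · simp only [smul_eq_mul, ENNReal.toReal_ofReal (h0 _ _),
      ENNReal.toReal_ofReal (sub_nonneg.2 (h1 _ _))]
  · exact Integrable.of_bound (hm'.mul hF).aestronglyMeasurable C (ae_of_all _ fun z =>
      b z _ (sub_nonneg.2 (h1 _ _)) (by linarith [h0 z.2 z.1]) _)
  · exact Integrable.of_bound (hm.mul hF').aestronglyMeasurable C (ae_of_all _ fun z =>
      b z _ (h0 _ _) (h1 _ _) _)

/-- The instances have the same distribution at training and at test. -/
theorem integral_trainDist_fst (p : Measure (X × Bool)) [IsProbabilityMeasure p]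
    {ρ : Bool → X → ℝ} (hρ : ∀ y, Measurable (ρ y)) (h0 : ∀ y x, 0 ≤ ρ y x)
    (h1 : ∀ y x, ρ y x ≤ 1) {F : X → ℝ} (hF : Measurable F) {C : ℝ} (hC : ∀ x, |F x| ≤ C) :
    ∫ x, F x ∂(p.map Prod.fst) = ∫ z, F z.1 ∂(trainDist p ρ) := by
  have hF' : Measurable fun z : X × Bool => F z.1 := hF.comp measurable_fst
  rw [integral_map measurable_fst.aemeasurable hF.aestronglyMeasurable,
    integral_trainDist p hρ h0 h1 hF' fun z => hC z.1]
  congr 1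
  funext z
  ring

/-- The loss of `h_μ` is the affine loss `1/2 - y ħ(x)ᵀ μ` plus at most the violation of the
constraint at `x`. -/
theorem one_sub_clip_le (c : ℝ) (y : Bool) :
    1 - clip (lab y * c + 1 / 2) ≤ 1 / 2 - lab y * c + max (|c| - 1 / 2) 0 := by
  have h : |lab y * c| = |c| := by rw [abs_mul, abs_lab, one_mul]
  rw [← h]
  generalize lab y * c = z
  have h1 := le_abs_self z
  have h2 := neg_abs_le z
  have h3 := le_max_left (|z| - 1 / 2) 0
  have h4 := le_max_right (|z| - 1 / 2) 0
  unfold clip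
  rcases le_total (z + 1 / 2) 1 with h | h
  · rw [min_eq_left h]
    have := le_max_left (z + 1 / 2) 0
    linarith
  · rw [min_eq_right h]
    have := le_max_left (1 : ℝ) 0
    linarith

theorem measurable_violation (H : BaseRules X T) (μ : Fin T → ℝ) (θ : ℝ) :
    Measurable fun x => max (|comb H μ x| - θ) 0 :=
  ((measurable_comb H μ).abs.sub measurable_const).max measurable_const

theorem violation_le (H : BaseRules X T) (μ : Fin T → ℝ) {θ : ℝ} (hθ : 0 ≤ θ) (x : X) :
    |max (|comb H μ x| - θ) 0| ≤ norm1 μ := by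
  rw [abs_of_nonneg (le_max_right _ _)]
  exact max_le (by linarith [abs_comb_le H μ x]) (norm1_nonneg μ)

theorem abs_lab_mul_comb_le (H : BaseRules X T) (μ : Fin T → ℝ) (z : X × Bool) :
    |lab z.2 * comb H μ z.1| ≤ norm1 μ := by
  rw [abs_mul, abs_lab, one_mul]
  exact abs_comb_le H μ z.1

theorem measurable_lab_mul_comb (H : BaseRules X T) (μ : Fin T → ℝ) :
    Measurable fun z : X × Bool => lab z.2 * comb H μ z.1 :=
  (measurable_lab.comp measurable_snd).mul ((measurable_comb H μ).comp measurable_fst)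

theorem risk_ruleOf_le (H : BaseRules X T) (p : Measure (X × Bool)) [IsProbabilityMeasure p]
    (μ : Fin T → ℝ) :
    risk p (ruleOf H μ) ≤ 1 / 2 - ∫ z, lab z.2 * comb H μ z.1 ∂p +
      ∫ x, max (|comb H μ x| - 1 / 2) 0 ∂(p.map Prod.fst) := by
  have hv := measurable_violation H μ (1 / 2)
  have hv' : Measurable fun z : X × Bool => max (|comb H μ z.1| - 1 / 2) 0 := hv.comp measurable_fst
  have i1 : Integrable (fun z : X × Bool => lab z.2 * comb H μ z.1) p :=
    Integrable.of_bound (measurable_lab_mul_comb H μ).aestronglyMeasurable (norm1 μ)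
      (ae_of_all _ fun z => abs_lab_mul_comb_le H μ z)
  have i2 : Integrable (fun z : X × Bool => max (|comb H μ z.1| - 1 / 2) 0) p :=
    Integrable.of_bound hv'.aestronglyMeasurable (norm1 μ)
      (ae_of_all _ fun z => violation_le H μ (by norm_num) z.1)
  have i3 : Integrable (fun z : X × Bool => 1 - (ruleOf H μ).prob z.2 z.1) p :=
    Integrable.of_bound (measurable_const.sub
      (ruleOf H μ).measurable_uncurry_prob).aestronglyMeasurable 1 (ae_of_all _ fun z => by
        rw [Real.norm_eq_abs, abs_le]
        constructor <;>
          linarith [(ruleOf H μ).prob_nonneg z.2 z.1, (ruleOf H μ).prob_le_one z.2 z.1])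
  rw [integral_map measurable_fst.aemeasurable hv.aestronglyMeasurable]
  have e : 1 / 2 - ∫ z, lab z.2 * comb H μ z.1 ∂p = ∫ z, (1 / 2 - lab z.2 * comb H μ z.1) ∂p := by
    rw [integral_sub (integrable_const _) i1]
    simp
  have i4 : Integrable (fun z : X × Bool => 1 / 2 - lab z.2 * comb H μ z.1) p :=
    (integrable_const _).sub i1
  rw [e, ← integral_add i4 i2]
  exact integral_mono i3 (i4.add i2) fun z => one_sub_clip_le _ _

/-- Flipping labels changes the expectation of `y ħ(x)ᵀ μ` by at most twice the noise level times
the norm of `μ`. -/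
theorem integral_trainDist_le (H : BaseRules X T) (p : Measure (X × Bool))
    [IsProbabilityMeasure p] {ρ : Bool → X → ℝ} (hρ : ∀ y, Measurable (ρ y))
    (h0 : ∀ y x, 0 ≤ ρ y x) (h1 : ∀ y x, ρ y x ≤ 1) (μ : Fin T → ℝ) :
    ∫ z, lab z.2 * comb H μ z.1 ∂(trainDist p ρ) ≤
      ∫ z, lab z.2 * comb H μ z.1 ∂p + 2 * pNoise p ρ * norm1 μ := by
  have hm := measurable_uncurry_bool hρ
  have hl := measurable_lab_mul_comb H μ
  have hb := abs_lab_mul_comb_le H μ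
  rw [integral_trainDist p hρ h0 h1 hl hb]
  have i1 : Integrable (fun z : X × Bool => lab z.2 * comb H μ z.1) p :=
    Integrable.of_bound hl.aestronglyMeasurable (norm1 μ) (ae_of_all _ hb)
  have i2 : Integrable (fun z : X × Bool => ρ z.2 z.1) p :=
    Integrable.of_bound hm.aestronglyMeasurable 1 (ae_of_all _ fun z => by
      rw [Real.norm_eq_abs, abs_of_nonneg (h0 _ _)]
      exact h1 _ _)
  have i3 : Integrable (fun z : X × Bool => ρ z.2 z.1 * (2 * norm1 μ)) p := i2.mul_const _
  have e : 2 * pNoise p ρ * norm1 μ = ∫ z, ρ z.2 z.1 * (2 * norm1 μ) ∂p := by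
    rw [integral_mul_const, pNoise]
    ring
  rw [e, ← integral_add i1 i3]
  have hflip : ∀ z : X × Bool, lab (!z.2) * comb H μ z.1 = -(lab z.2 * comb H μ z.1) := by
    rintro ⟨x, y⟩
    cases y <;> simp [lab]
  simp only [hflip]
  have hpt : ∀ z : X × Bool, (1 - ρ z.2 z.1) * (lab z.2 * comb H μ z.1) +
      ρ z.2 z.1 * -(lab z.2 * comb H μ z.1) ≤
        lab z.2 * comb H μ z.1 + ρ z.2 z.1 * (2 * norm1 μ) := fun z => by
    have := mul_le_mul_of_nonneg_left (neg_le_of_abs_le (hb z)) (h0 z.2 z.1)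
    nlinarith
  refine integral_mono ?_ (i1.add i3) hpt
  refine Integrable.of_bound (((measurable_const.sub hm).mul hl).add
    (hm.mul hl.neg)).aestronglyMeasurable (2 * norm1 μ) (ae_of_all _ fun z => ?_)
  have e : (1 - ρ z.2 z.1) * (lab z.2 * comb H μ z.1) +
      ρ z.2 z.1 * -(lab z.2 * comb H μ z.1) =
        (1 - 2 * ρ z.2 z.1) * (lab z.2 * comb H μ z.1) := by ring
  rw [e, Real.norm_eq_abs, abs_mul]
  have h2 : |1 - 2 * ρ z.2 z.1| ≤ 1 := abs_le.2 (by
    constructor <;> linarith [h0 z.2 z.1, h1 z.2 z.1])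
  have := mul_le_mul h2 (hb z) (abs_nonneg _) zero_le_one
  linarith [norm1_nonneg μ]

theorem sum_mul_empMean_le (H : BaseRules X T) {q : Measure (X × Bool)} [IsProbabilityMeasure q]
    {S : Fin n → X × Bool} {ε : ℝ} (hε : IsEstBound H q S ε) (μ : Fin T → ℝ) :
    ∑ j, μ j * empMean H S j ≤ ∫ z, lab z.2 * comb H μ z.1 ∂q + ε * norm1 μ := by
  have hi : ∀ j, Integrable (fun z : X × Bool => lab z.2 * H.rule j z.1) q := fun j =>
    Integrable.of_bound ((measurable_lab.comp measurable_snd).mul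
      ((H.measurable_rule j).comp measurable_fst)).aestronglyMeasurable 1 (ae_of_all _ fun z => by
        rw [Real.norm_eq_abs, abs_mul]
        exact mul_le_one₀ (abs_lab_le _) (abs_nonneg _) (H.abs_rule_le j z.1))
  have e : ∫ z, lab z.2 * comb H μ z.1 ∂q = ∑ j, μ j * ∫ z, lab z.2 * H.rule j z.1 ∂q := by
    simp_rw [← integral_const_mul]
    rw [← integral_finsetSum _ fun j _ => (hi j).const_mul _]
    congr 1
    funext z
    rw [comb, Finset.mul_sum]
    exact Finset.sum_congr rfl fun j _ => by ring
  rw [e, norm1, Finset.mul_sum, ← Finset.sum_add_distrib]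
  refine Finset.sum_le_sum fun j _ => ?_
  have h1 : μ j * (empMean H S j - ∫ z, lab z.2 * H.rule j z.1 ∂q) ≤ |μ j| * ε := by
    refine (le_abs_self _).trans ?_
    rw [abs_mul, abs_sub_comm]
    exact mul_le_mul_of_nonneg_left (hε j) (abs_nonneg _)
  linarith

theorem risk_ruleOf_le_objective (H : BaseRules X T) (p : Measure (X × Bool))
    [IsProbabilityMeasure p] {ρ : Bool → X → ℝ} (hρ : ∀ y, Measurable (ρ y))
    (h0 : ∀ y x, 0 ≤ ρ y x) (h1 : ∀ y x, ρ y x ≤ 1) {S : Fin n → X × Bool} (lam : ℝ) {ε : ℝ}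
    (hε : IsEstBound H (trainDist p ρ) S ε) (μ : Fin T → ℝ) :
    risk p (ruleOf H μ) ≤ objective H S lam μ +
      ∫ x, max (|comb H μ x| - 1 / 2) 0 ∂(p.map Prod.fst) +
        (ε + 2 * pNoise p ρ - lam) * norm1 μ := by
  have := isProbabilityMeasure_trainDist p hρ h0 h1
  have a1 := risk_ruleOf_le H p μ
  have a2 := integral_trainDist_le H p hρ h0 h1 μ
  have a3 := sum_mul_empMean_le H hε μ
  rw [objective, sum_lab_mul_comb]
  linarith

end RMBoost

namespace RMBoost

/-! ### The bounded differences inequality -/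

/-- McDiarmid's inequality in its moment generating function form: a function of `n` independent
variables that changes by at most `c` when one of them changes is sub-Gaussian. By induction on
`n`: Hoeffding's lemma is applied to the expectation over all variables but the first. -/
theorem hasSubgaussianMGF_of_bounded_differences {Ω : Type*} [MeasurableSpace Ω] (P : Measure Ω)
    [IsProbabilityMeasure P] (c : NNReal) {B : ℝ} :
    ∀ (n : ℕ) (G : (Fin n → Ω) → ℝ), Measurable G → (∀ x, |G x| ≤ B) →
      (∀ x i y, G (Function.update x i y) ≤ G x + c) →
      ProbabilityTheory.HasSubgaussianMGF
        (fun x => G x - ∫ x', G x' ∂(Measure.pi fun _ : Fin n => P)) (n * (c / 2) ^ 2)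
        (Measure.pi fun _ : Fin n => P) := by
  intro n
  induction n with
  | zero =>
    intro G _ _ _
    have e : (fun x => G x - ∫ x', G x' ∂(Measure.pi fun _ : Fin 0 => P)) = fun _ => 0 := by
      funext x
      have : G = fun _ => G x := funext fun x' => congrArg G (Subsingleton.elim _ _)
      rw [this]
      simp
    rw [e]
    simp
  | succ n ih =>
    intro G hG hB hc
    set Q : Measure (Fin n → Ω) := Measure.pi fun _ : Fin n => P with hQ
    have mp := measurePreserving_piFinSuccAbove (fun _ : Fin (n + 1) => P) 0
    set e := MeasurableEquiv.piFinSuccAbove (fun _ : Fin (n + 1) => Ω) 0 with he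
    set G' : Ω × (Fin n → Ω) → ℝ := fun q => G (Fin.cons q.1 q.2) with hG'
    have hGe : ∀ x, G x = G' (e x) := fun x => by
      simp only [hG', he, MeasurableEquiv.piFinSuccAbove_apply]
      congr 1
      exact (Fin.cons_self_tail x).symm
    have hGm : Measurable G' := by
      have : G' = G ∘ e.symm := by
        funext q
        rw [Function.comp, hGe, e.apply_symm_apply]
      rw [this]
      exact hG.comp e.symm.measurable
    have hB' : ∀ q, |G' q| ≤ B := fun q => hB _
    have hB0 : 0 ≤ B := by
      obtain ⟨q⟩ : Nonempty (Ω × (Fin n → Ω)) := (P.prod Q).nonempty_of_neZero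
      exact (abs_nonneg _).trans (hB' q)
    have hGi : ∀ y, Integrable (fun x => G' (y, x)) Q := fun y =>
      Integrable.of_bound (hGm.comp measurable_prodMk_left).aestronglyMeasurable B
        (ae_of_all _ fun x => hB' _)
    -- the expectation over all variables but the first
    set K : Ω → ℝ := fun y => ∫ x, G' (y, x) ∂Q with hK
    have hKm : Measurable K := (hGm.stronglyMeasurable.integral_prod_right (ν := Q)).measurable
    have hKB : ∀ y, |K y| ≤ B := fun y => by
      have := norm_integral_le_of_norm_le_const (μ := Q) (f := fun x => G' (y, x))
        (ae_of_all Q fun x => hB' (y, x))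
      simpa using this
    have hKc : ∀ y y', K y ≤ K y' + c := fun y y' => by
      have h1 : K y ≤ ∫ x, (G' (y', x) + c) ∂Q := by
        refine integral_mono (hGi y) ((hGi y').add (integrable_const _)) fun x => ?_
        have := hc (Fin.cons y' x) 0 y
        rwa [Fin.update_cons_zero] at this
      rwa [integral_add (hGi y') (integrable_const _), integral_const, probReal_univ, one_smul]
        at h1
    have hKsub : ProbabilityTheory.HasSubgaussianMGF (fun y => K y - ∫ y', K y' ∂P)
        ((c / 2) ^ 2) P := by
      have hbdd : BddBelow (Set.range K) := ⟨-B, by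
        rintro _ ⟨y, rfl⟩
        exact neg_le_of_abs_le (hKB y)⟩
      have : Nonempty Ω := P.nonempty_of_neZero
      have h := ProbabilityTheory.hasSubgaussianMGF_of_mem_Icc (μ := P) (X := K) (a := ⨅ y, K y)
        (b := (⨅ y, K y) + c) hKm.aemeasurable (ae_of_all _ fun y => ⟨ciInf_le hbdd y, by
          rw [← sub_le_iff_le_add]
          exact le_ciInf fun y' => by linarith [hKc y y']⟩)
      simpa using h
    have hm : ∫ x, G x ∂(Measure.pi fun _ : Fin (n + 1) => P) = ∫ y, K y ∂P := by
      simp_rw [hGe]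
      rw [mp.integral_comp' (g := G'), integral_prod]
      exact Integrable.of_bound hGm.aestronglyMeasurable B (ae_of_all _ hB')
    rw [hm]
    set m := ∫ y, K y ∂P with hmdef
    have hcore : ProbabilityTheory.HasSubgaussianMGF (fun q => G' q - m)
        (((n + 1 : ℕ) : NNReal) * (c / 2) ^ 2) (P.prod Q) := by
      have hmB : |m| ≤ B := by
        have := norm_integral_le_of_norm_le_const (μ := P) (f := K) (ae_of_all P hKB)
        simpa using this
      have hint : ∀ t : ℝ, Integrable (fun q => Real.exp (t * (G' q - m))) (P.prod Q) := fun t => by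
        refine Integrable.of_bound (((hGm.sub_const m).const_mul t).exp).aestronglyMeasurable
          (Real.exp (|t| * (B + B))) (ae_of_all _ fun q => ?_)
        rw [Real.norm_eq_abs, Real.abs_exp]
        refine Real.exp_le_exp.2 ((le_abs_self _).trans ?_)
        rw [abs_mul]
        exact mul_le_mul_of_nonneg_left ((abs_sub _ _).trans (add_le_add (hB' q) hmB))
          (abs_nonneg t)
      refine ⟨hint, fun t => ?_⟩
      have hin : ∀ y, ∫ x, Real.exp (t * (G' (y, x) - m)) ∂Q ≤
          Real.exp (t * (K y - m)) * Real.exp (n * (c / 2) ^ 2 * t ^ 2 / 2) := fun y => by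
        have h := (ih (fun x => G' (y, x)) (hGm.comp measurable_prodMk_left) (fun x => hB' _)
          fun x i w => by
            have := hc (Fin.cons y x) i.succ w
            rwa [← Fin.cons_update] at this).mgf_le t
        have e1 : ∀ x, Real.exp (t * (G' (y, x) - m)) =
            Real.exp (t * (K y - m)) * Real.exp (t * (G' (y, x) - K y)) := fun x => by
          rw [← Real.exp_add]
          congr 1
          ring
        simp_rw [e1]
        rw [integral_const_mul]
        refine mul_le_mul_of_nonneg_left ?_ (Real.exp_pos _).le
        simpa [ProbabilityTheory.mgf] using h
      rw [ProbabilityTheory.mgf, integral_prod _ (hint t)]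
      refine (integral_mono_of_nonneg (ae_of_all _ fun y =>
        integral_nonneg fun x => (Real.exp_pos _).le)
          ((hKsub.integrable_exp_mul t).mul_const _) (ae_of_all _ hin)).trans ?_
      rw [integral_mul_const]
      refine (mul_le_mul_of_nonneg_right (hKsub.mgf_le t) (Real.exp_pos _).le).trans ?_
      rw [← Real.exp_add]
      refine (congrArg Real.exp ?_).le
      push_cast
      ring
    have h := hcore
    rw [← mp.map_eq] at h
    have h' := h.of_map mp.measurable.aemeasurable
    convert h' using 1
    funext x
    simp only [Function.comp, hGe]

/-- **McDiarmid's inequality**. -/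
theorem measureReal_pi_le_of_bounded_differences {Ω : Type*} [MeasurableSpace Ω] (P : Measure Ω)
    [IsProbabilityMeasure P] {c B : ℝ} (hc0 : 0 ≤ c) {n : ℕ} {G : (Fin n → Ω) → ℝ}
    (hG : Measurable G) (hB : ∀ x, |G x| ≤ B)
    (hc : ∀ x i y, G (Function.update x i y) ≤ G x + c) {t : ℝ} (ht : 0 ≤ t) :
    (Measure.pi fun _ : Fin n => P).real
      {x | ∫ x', G x' ∂(Measure.pi fun _ : Fin n => P) + t ≤ G x} ≤
        Real.exp (-2 * t ^ 2 / (n * c ^ 2)) := by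
  lift c to NNReal using hc0
  have h := (hasSubgaussianMGF_of_bounded_differences P c n G hG hB hc).measure_ge_le ht
  have e1 : -t ^ 2 / (2 * ((n * (c / 2) ^ 2 : NNReal) : ℝ)) = -2 * t ^ 2 / (n * c ^ 2) := by
    push_cast
    rw [div_pow, show 2 * ((n : ℝ) * ((c : ℝ) ^ 2 / 2 ^ 2)) = n * (c : ℝ) ^ 2 / 2 by ring,
      div_div_eq_mul_div]
    congr 1
    ring
  rw [e1] at h
  simpa only [le_sub_iff_add_le'] using h

end RMBoost

namespace RMBoost

variable {X : Type*} [MeasurableSpace X] {T n : ℕ}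

/-! ### The contraction principle for exponential moments -/

theorem exp_add_exp_le_of_majorized {a b A B : ℝ} (hsum : a + b ≤ A + B)
    (ha : a ≤ max A B) (hb : b ≤ max A B) : Real.exp a + Real.exp b ≤ Real.exp A + Real.exp B := by
  wlog hAB : B ≤ A generalizing A B
  · have := this (A := B) (B := A) (by linarith) (by rwa [max_comm]) (by rwa [max_comm])
      (le_of_not_ge hAB)
    linarith
  wlog hab : b ≤ a generalizing a b
  · have := this (a := b) (b := a) (by linarith) hb ha (le_of_not_ge hab)
    linarith
  rw [max_eq_left hAB] at ha
  rcases le_total b B with h | h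
  · exact add_le_add (Real.exp_le_exp.2 ha) (Real.exp_le_exp.2 h)
  · have e1 : Real.exp A = Real.exp a * Real.exp (A - a) := by
      rw [← Real.exp_add]
      congr 1
      ring
    have e2 : Real.exp b = Real.exp B * Real.exp (b - B) := by
      rw [← Real.exp_add]
      congr 1
      ring
    have h1 : Real.exp B ≤ Real.exp a := Real.exp_le_exp.2 (h.trans hab)
    have h2 : Real.exp (b - B) ≤ Real.exp (A - a) := Real.exp_le_exp.2 (by linarith)
    have h3 : 1 ≤ Real.exp (b - B) := Real.one_le_exp (by linarith)
    rw [e1, e2]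
    nlinarith [Real.exp_pos B]

variable {ι J : Type*} [Finite ι]

theorem le_ciSup_finite (v : ι → ℝ) (a : ι) : v a ≤ ⨆ a, v a :=
  le_ciSup (Set.finite_range v).bddAbove a

variable [Nonempty ι]

theorem exp_iSup_contraction_step {lam : ℝ} (hlam : 0 ≤ lam) {φ : ℝ → ℝ}
    (hφ : ∀ a b, |φ a - φ b| ≤ |a - b|) (h0 : φ 0 = 0) (u t : ι → ℝ) :
    Real.exp (lam * ⨆ a, (u a + φ (t a))) + Real.exp (lam * ⨆ a, (u a - φ (t a))) ≤
      Real.exp (lam * ⨆ a, (u a + t a)) + Real.exp (lam * ⨆ a, (u a - t a)) := by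
  obtain ⟨f, hf⟩ := exists_eq_ciSup_of_finite (f := fun a => u a + φ (t a))
  obtain ⟨g, hg⟩ := exists_eq_ciSup_of_finite (f := fun a => u a - φ (t a))
  rw [← hf, ← hg]
  have hA := le_ciSup_finite fun a => u a + t a
  have hB := le_ciSup_finite fun a => u a - t a
  set A := ⨆ a, (u a + t a)
  set B := ⨆ a, (u a - t a)
  have hφt : ∀ a, |φ (t a)| ≤ |t a| := fun a => by simpa [h0] using hφ (t a) 0
  have hmax : max (lam * A) (lam * B) = lam * max A B := (mul_max_of_nonneg A B hlam).symm
  have hle : ∀ a, u a + |t a| ≤ max A B := fun a => by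
    rcases abs_cases (t a) with ⟨h, _⟩ | ⟨h, _⟩ <;> rw [h]
    · exact (hA a).trans (le_max_left _ _)
    · exact (hB a).trans (le_max_right _ _)
  refine exp_add_exp_le_of_majorized ?_ ?_ ?_
  · rw [← mul_add, ← mul_add]
    refine mul_le_mul_of_nonneg_left ?_ hlam
    have h1 := (le_abs_self _).trans (hφ (t f) (t g))
    rcases abs_cases (t f - t g) with ⟨h, _⟩ | ⟨h, _⟩ <;> rw [h] at h1
    · linarith [hA f, hB g]
    · linarith [hA g, hB f]
  · rw [hmax]
    exact mul_le_mul_of_nonneg_left (by linarith [hle f, le_abs_self (φ (t f)), hφt f]) hlam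
  · rw [hmax]
    exact mul_le_mul_of_nonneg_left (by linarith [hle g, neg_abs_le (φ (t g)), hφt g]) hlam

/-- A sum over all sign vectors is unchanged if each term is replaced by the average over the two
signs at one place. -/
theorem two_mul_sum_signs [Fintype J] [DecidableEq J] (j : J) (F : (J → Bool) → ℝ) :
    2 * ∑ σ, F σ = ∑ σ, (F σ + F (Function.update σ j (!σ j))) := by
  have hinv : Function.Involutive fun σ : J → Bool => Function.update σ j (!σ j) := fun σ => by
    simp
  rw [Finset.sum_add_distrib, two_mul]
  congr 1
  exact (Equiv.sum_comp hinv.toPerm F).symm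

/-- The contraction principle for the exponential moments of the maximum of a finite Rademacher
process (with the sums over sign vectors not normalized). -/
theorem sum_exp_iSup_contraction [Fintype J] [DecidableEq J] {lam : ℝ} (hlam : 0 ≤ lam) {φ : ℝ → ℝ}
    (hφ : ∀ a b, |φ a - φ b| ≤ |a - b|) (h0 : φ 0 = 0) (t : ι → J → ℝ) :
    ∑ σ : J → Bool, Real.exp (lam * ⨆ a, ∑ j, lab (σ j) * φ (t a j)) ≤
      ∑ σ : J → Bool, Real.exp (lam * ⨆ a, ∑ j, lab (σ j) * t a j) := by
  have key : ∀ s : Finset J,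
      ∑ σ : J → Bool, Real.exp (lam * ⨆ a, ∑ j, lab (σ j) * if j ∈ s then φ (t a j) else t a j) ≤
        ∑ σ : J → Bool, Real.exp (lam * ⨆ a, ∑ j, lab (σ j) * t a j) := by
    intro s
    induction s using Finset.induction_on with
    | empty => simp
    | insert j₀ s hj₀ ih =>
      refine le_trans ?_ ih
      refine le_of_mul_le_mul_left ?_ (two_pos (α := ℝ))
      rw [two_mul_sum_signs j₀, two_mul_sum_signs j₀]
      refine Finset.sum_le_sum fun σ _ => ?_
      set u : ι → ℝ := fun a => ∑ j ∈ Finset.univ.erase j₀,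
        lab (σ j) * if j ∈ s then φ (t a j) else t a j with hu
      have e : ∀ (b : Bool) (r : ι → ℝ) (s' : Finset J), (∀ j ≠ j₀, j ∈ s' ↔ j ∈ s) →
          (∀ a, (if j₀ ∈ s' then φ (t a j₀) else t a j₀) = r a) → ∀ a,
          ∑ j, lab (Function.update σ j₀ b j) * (if j ∈ s' then φ (t a j) else t a j) =
            u a + lab b * r a := fun b r s' hs' hr a => by
        rw [← Finset.sum_erase_add _ _ (Finset.mem_univ j₀), Function.update_self, hr a, hu]
        congr 1
        refine Finset.sum_congr rfl fun j hj => ?_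
        have hj' := Finset.ne_of_mem_erase hj
        simp only [Function.update_of_ne hj', hs' j hj']
      have hins : ∀ j ≠ j₀, j ∈ insert j₀ s ↔ j ∈ s := fun j hj => by simp [hj]
      have e1 := fun b => e b (fun a => φ (t a j₀)) (insert j₀ s) hins (by simp)
      have e2 := fun b => e b (fun a => t a j₀) s (fun _ _ => Iff.rfl) (by simp [hj₀])
      have hstep := exp_iSup_contraction_step hlam hφ h0 u fun a => t a j₀
      have hσ : σ = Function.update σ j₀ (σ j₀) := (Function.update_eq_self _ _).symm
      have e1' := e1 (σ j₀)
      have e2' := e2 (σ j₀)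
      rw [← hσ] at e1' e2'
      simp only [e1', e2', e1, e2]
      cases σ j₀ with
      | false =>
        simp only [lab, Bool.not_false, if_true, Bool.false_eq_true, if_false, one_mul, neg_one_mul,
          ← sub_eq_add_neg]
        linarith
      | true =>
        simp only [lab, Bool.not_true, if_true, Bool.false_eq_true, if_false, one_mul, neg_one_mul,
          ← sub_eq_add_neg]
        exact hstep
  simpa using key Finset.univ

/-! ### The growth function of the base-rules -/

theorem card_le_of_subgraphShatters {H : BaseRules X T} {s : Finset (X × ℝ)}
    (hs : SubgraphShatters H s) : s.card ≤ vcDim H := by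
  refine le_csSup ⟨T, ?_⟩ ⟨s, rfl, hs⟩
  rintro _ ⟨s, rfl, hs⟩
  have : Nonempty (Fin T) := (hs ∅ (Finset.empty_subset _)).nonempty
  choose! f hf using hs
  have hinj : Set.InjOn f (s.powerset : Set (Finset (X × ℝ))) := fun A hA B hB hAB => by
    have hA' := Finset.mem_powerset.1 hA
    have hB' := Finset.mem_powerset.1 hB
    ext z
    constructor <;> intro hz
    · exact (hf B hB' z (hA' hz)).2 (hAB ▸ (hf A hA' z (hA' hz)).1 hz)
    · exact (hf A hA' z (hB' hz)).2 (hAB ▸ (hf B hB' z (hB' hz)).1 hz)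
  have h1 := Finset.card_le_card_of_injOn f (t := Finset.univ) (fun _ _ => Finset.mem_univ _) hinj
  rw [Finset.card_powerset, Finset.card_univ, Fintype.card_fin] at h1
  exact (Nat.lt_two_pow_self).le.trans h1

/-- The subsets of `J` cut out of the points `z j` by the base-rules with the threshold `t`. -/
noncomputable def traces [Fintype J] (H : BaseRules X T) (z : J → X) (t : ℝ) :
    Finset (Finset J) := by
  classical
  exact Finset.univ.image fun k => Finset.univ.filter fun j => t < H.rule k (z j)

/-- The traces with one threshold are traces of the subgraphs, hence the Sauer-Shelah lemma. -/
theorem card_traces_le [Fintype J] (H : BaseRules X T) (z : J → X) (t : ℝ) :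
    (traces H z t).card ≤ ∑ k ∈ Finset.Iic (vcDim H), (Fintype.card J).choose k := by
  classical
  refine (Finset.card_le_card_shatterer _).trans (Finset.card_shatterer_le_sum_vcDim.trans
    (Finset.sum_le_sum_of_subset (Finset.Iic_subset_Iic.2 (Finset.sup_le fun s hs => ?_))))
  have hs' := Finset.mem_shatterer.1 hs
  have htr : ∀ A ⊆ s, ∃ k, ∀ j ∈ s, j ∈ A ↔ t < H.rule k (z j) := fun A hA => by
    obtain ⟨B, hB, hBA⟩ := hs' hA
    simp only [traces, Finset.mem_image, Finset.mem_univ, true_and] at hB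
    obtain ⟨k, rfl⟩ := hB
    refine ⟨k, fun j hj => ?_⟩
    rw [← hBA]
    simp [hj]
  have hinj : Set.InjOn (fun j => (z j, t)) (s : Set J) := fun j hj j' hj' h => by
    obtain ⟨k, hk⟩ := htr {j} (Finset.singleton_subset_iff.2 hj)
    have h1 := (hk j hj).1 (Finset.mem_singleton_self j)
    have hz : z j = z j' := (Prod.ext_iff.1 h).1
    rw [hz] at h1
    exact (Finset.mem_singleton.1 ((hk j' hj').2 h1)).symm
  rw [← Finset.card_image_of_injOn hinj]
  refine card_le_of_subgraphShatters fun A hA => ?_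
  obtain ⟨k, hk⟩ := htr (s.filter fun j => (z j, t) ∈ A) (Finset.filter_subset _ _)
  refine ⟨k, fun w hw => ?_⟩
  obtain ⟨j, hj, rfl⟩ := Finset.mem_image.1 hw
  rw [← hk j hj]
  simp [hj]

theorem sum_choose_le {D m : ℕ} (hD : 1 ≤ D) (hm : D ≤ m) :
    ((∑ k ∈ Finset.Iic D, m.choose k : ℕ) : ℝ) ≤ (Real.exp 1 * m / D) ^ D := by
  have hD0 : (0 : ℝ) < D := by exact_mod_cast hD
  have hm0 : (0 : ℝ) < m := by exact_mod_cast hD.trans hm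
  have hx : (1 : ℝ) ≤ m / D := (one_le_div hD0).2 (by exact_mod_cast hm)
  have h1 : ((∑ k ∈ Finset.Iic D, m.choose k : ℕ) : ℝ) ≤
      ∑ k ∈ Finset.range (m + 1), (m / D : ℝ) ^ D * ((D / m : ℝ) ^ k * m.choose k) := by
    push_cast
    refine (Finset.sum_le_sum fun k hk => ?_).trans (Finset.sum_le_sum_of_subset_of_nonneg
      (fun k hk => Finset.mem_range.2 ((Finset.mem_Iic.1 hk).trans_lt (Nat.lt_succ_of_le hm)))
      fun k _ _ => by positivity)
    have hk' := Finset.mem_Iic.1 hk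
    have e : (m / D : ℝ) ^ D * (D / m : ℝ) ^ k = (m / D : ℝ) ^ (D - k) := by
      rw [← Nat.sub_add_cancel hk', pow_add, mul_assoc, ← mul_pow, Nat.sub_add_cancel hk',
        div_mul_div_cancel₀ hD0.ne', div_self hm0.ne', one_pow, mul_one]
    rw [← mul_assoc, e]
    exact le_mul_of_one_le_left (Nat.cast_nonneg _) (one_le_pow₀ hx)
  refine h1.trans ?_
  have h2 : ∑ k ∈ Finset.range (m + 1), (D / m : ℝ) ^ k * m.choose k = (D / m + 1 : ℝ) ^ m := by
    rw [add_pow]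
    simp
  have h3 : (D / m + 1 : ℝ) ^ m ≤ Real.exp 1 ^ D := by
    refine (pow_le_pow_left₀ (by positivity) (Real.add_one_le_exp (D / m : ℝ)) m).trans ?_
    rw [← Real.exp_nat_mul, ← Real.exp_nat_mul, mul_div_cancel₀ _ hm0.ne', mul_one]
  rw [← Finset.mul_sum, h2, mul_div_assoc, mul_pow, mul_comm]
  exact mul_le_mul_of_nonneg_right h3 (by positivity)

/-! ### Exponential moments of the Rademacher process of the base-rules -/

theorem sum_exp_signs_le [Fintype J] [DecidableEq J] (lam : ℝ) (v : J → ℝ) (hv : ∀ j, |v j| = 1) :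
    ∑ σ : J → Bool, Real.exp (lam * ∑ j, lab (σ j) * v j) ≤
      2 ^ Fintype.card J * Real.exp (lam ^ 2 * Fintype.card J / 2) := by
  have e : ∀ σ : J → Bool, Real.exp (lam * ∑ j, lab (σ j) * v j) =
      ∏ j, Real.exp (lam * (lab (σ j) * v j)) := fun σ => by
    rw [Finset.mul_sum, Real.exp_sum]
  simp_rw [e]
  have h := Finset.prod_univ_sum (fun _ : J => (Finset.univ : Finset Bool))
    fun j b => Real.exp (lam * (lab b * v j))
  rw [Fintype.piFinset_univ] at h
  rw [← h]
  have h1 : ∀ j ∈ (Finset.univ : Finset J), ∑ b : Bool, Real.exp (lam * (lab b * v j)) ≤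
      2 * Real.exp (lam ^ 2 / 2) := fun j _ => by
    have hc := Real.cosh_le_exp_half_sq (lam * v j)
    rw [Real.cosh_eq, mul_pow, ← sq_abs (v j), hv j, one_pow, mul_one] at hc
    rw [Fintype.sum_bool]
    simp only [lab, if_true, Bool.false_eq_true, if_false, one_mul, neg_one_mul, mul_neg]
    linarith
  refine (Finset.prod_le_prod (fun j _ => Finset.sum_nonneg fun b _ => (Real.exp_pos _).le)
    h1).trans ?_
  rw [Finset.prod_const, Finset.card_univ, mul_pow, ← Real.exp_nat_mul]
  refine (congrArg _ (congrArg _ ?_)).le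
  ring

/-- The sign of `v - t`. -/
noncomputable def thresholdSign (t v : ℝ) : ℝ := if t < v then 1 else -1

theorem abs_thresholdSign (t v : ℝ) : |thresholdSign t v| = 1 := by
  unfold thresholdSign
  split_ifs <;> simp

theorem measurable_thresholdSign (v : ℝ) : Measurable fun t => thresholdSign t v :=
  Measurable.ite measurableSet_Iio measurable_const measurable_const

/-- The uniform distribution of a threshold in `[-1, 1]`. -/
noncomputable def thresholdMeasure : Measure ℝ :=
  ENNReal.ofReal (1 / 2) • volume.restrict (Set.Ioc (-1) 1)

theorem thresholdMeasure_apply {v : ℝ} (h : v ≤ 1) :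
    thresholdMeasure (Set.Iio v) = ENNReal.ofReal ((v + 1) / 2) := by
  rw [thresholdMeasure, Measure.smul_apply, Measure.restrict_apply measurableSet_Iio]
  have e : volume (Set.Iio v ∩ Set.Ioc (-1) 1) = ENNReal.ofReal (v + 1) := by
    have : Set.Iio v ∩ Set.Ioc (-1) 1 = Set.Ioo (-1) v := by
      ext x
      simp only [Set.mem_inter_iff, Set.mem_Iio, Set.mem_Ioc, Set.mem_Ioo]
      constructor
      · rintro ⟨h₁, h₂, _⟩
        exact ⟨h₂, h₁⟩
      · rintro ⟨h₁, h₂⟩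
        exact ⟨h₂, h₁, by linarith⟩
    rw [this, Real.volume_Ioo, sub_neg_eq_add]
  rw [e, smul_eq_mul, ← ENNReal.ofReal_mul (by norm_num)]
  congr 1
  ring

instance : IsProbabilityMeasure thresholdMeasure := by
  refine ⟨?_⟩
  rw [thresholdMeasure, Measure.smul_apply, Measure.restrict_apply MeasurableSet.univ,
    Set.univ_inter, Real.volume_Ioc, smul_eq_mul, ← ENNReal.ofReal_mul (by norm_num)]
  norm_num

theorem integral_thresholdSign {v : ℝ} (h : |v| ≤ 1) :
    ∫ t, thresholdSign t v ∂thresholdMeasure = v := by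
  obtain ⟨h1, h2⟩ := abs_le.1 h
  have e : ∀ t, thresholdSign t v = 2 *
      (Set.Iio v).indicator (fun _ => (1 : ℝ)) t - 1 := fun t => by
    by_cases ht : t < v
    · rw [thresholdSign, if_pos ht, Set.indicator_of_mem (Set.mem_Iio.2 ht)]
      norm_num
    · rw [thresholdSign, if_neg ht, Set.indicator_of_notMem (by simpa using ht)]
      norm_num
  simp_rw [e]
  rw [integral_sub (((integrable_const _).indicator measurableSet_Iio).const_mul _)
    (integrable_const _), integral_const_mul, integral_indicator_const _ measurableSet_Iio,
    Measure.real, thresholdMeasure_apply h2, ENNReal.toReal_ofReal (by linarith)]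
  simp only [smul_eq_mul, mul_one, integral_const, probReal_univ]
  ring

/-- Massart's bound for the signs of the base-rules with respect to one threshold. -/
theorem sum_exp_iSup_thresholdSign_le [Fintype J] [DecidableEq J] [Nonempty (Fin T)]
    (H : BaseRules X T)
    (z : J → X) (lam t : ℝ) :
    ∑ σ : J → Bool, Real.exp (lam * ⨆ k, ∑ j, lab (σ j) * thresholdSign t (H.rule k (z j))) ≤
      2 ^ Fintype.card J * ((traces H z t).card * Real.exp (lam ^ 2 * Fintype.card J / 2)) := by
  set v : Finset J → J → ℝ := fun B j => if j ∈ B then 1 else -1 with hv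
  have h1 : ∀ σ : J → Bool,
      Real.exp (lam * ⨆ k, ∑ j, lab (σ j) * thresholdSign t (H.rule k (z j))) ≤
        ∑ B ∈ traces H z t, Real.exp (lam * ∑ j, lab (σ j) * v B j) := fun σ => by
    obtain ⟨k, hk⟩ := exists_eq_ciSup_of_finite
      (f := fun k => ∑ j, lab (σ j) * thresholdSign t (H.rule k (z j)))
    rw [← hk]
    have hmem : (Finset.univ.filter fun j => t < H.rule k (z j)) ∈ traces H z t := by
      simp only [traces, Finset.mem_image, Finset.mem_univ, true_and]
      exact ⟨k, rfl⟩
    have := Finset.single_le_sum (f := fun B => Real.exp (lam * ∑ j, lab (σ j) * v B j))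
      (fun _ _ => (Real.exp_pos _).le) hmem
    simpa [hv, thresholdSign] using this
  refine (Finset.sum_le_sum fun σ _ => h1 σ).trans ?_
  rw [Finset.sum_comm]
  refine (Finset.sum_le_card_nsmul _ _ _ fun B _ => sum_exp_signs_le lam (v B) fun j => ?_).trans ?_
  · simp only [hv]
    split_ifs <;> simp
  · rw [nsmul_eq_mul]
    exact le_of_eq (by ring)

/-- A base-rule is the average of its signs with respect to a uniform threshold, so the exponential
moments of the real-valued base-rules are bounded by those of one threshold. -/
theorem sum_exp_iSup_rule_le [Fintype J] [DecidableEq J] [Nonempty (Fin T)]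
    (H : BaseRules X T) (z : J → X)
    {lam : ℝ} (hlam : 0 ≤ lam) {N : ℝ} (hN : ∀ t, ((traces H z t).card : ℝ) ≤ N) :
    ∑ σ : J → Bool, Real.exp (lam * ⨆ k, ∑ j, lab (σ j) * H.rule k (z j)) ≤
      2 ^ Fintype.card J * (N * Real.exp (lam ^ 2 * Fintype.card J / 2)) := by
  set W : (J → Bool) → ℝ → ℝ := fun σ t =>
    ⨆ k, ∑ j, lab (σ j) * thresholdSign t (H.rule k (z j)) with hW
  have hm : ∀ (σ : J → Bool) k, Measurable fun t =>
      ∑ j, lab (σ j) * thresholdSign t (H.rule k (z j)) :=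
    fun σ k => Finset.measurable_sum _ fun j _ => (measurable_thresholdSign _).const_mul _
  have hWm : ∀ σ, Measurable (W σ) := fun σ => Measurable.iSup fun k => hm σ k
  have hb : ∀ (σ : J → Bool) k t,
      |∑ j, lab (σ j) * thresholdSign t (H.rule k (z j))| ≤ Fintype.card J :=
    fun σ k t => by
      refine (Finset.abs_sum_le_sum_abs _ _).trans ?_
      simp [abs_mul, abs_lab, abs_thresholdSign]
  have hWb : ∀ σ t, |W σ t| ≤ Fintype.card J := fun σ t => by
    obtain ⟨k, hk⟩ := exists_eq_ciSup_of_finite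
      (f := fun k => ∑ j, lab (σ j) * thresholdSign t (H.rule k (z j)))
    simp only [hW]
    rw [← hk]
    exact hb σ k t
  have hWi : ∀ σ, Integrable (W σ) thresholdMeasure := fun σ =>
    Integrable.of_bound (hWm σ).aestronglyMeasurable _ (ae_of_all _ (hWb σ))
  have hEi : ∀ σ, Integrable (fun t => Real.exp (lam * W σ t)) thresholdMeasure := fun σ =>
    Integrable.of_bound ((hWm σ).const_mul lam).exp.aestronglyMeasurable
      (Real.exp (lam * Fintype.card J)) (ae_of_all _ fun t => by
        rw [Real.norm_eq_abs, Real.abs_exp]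
        exact Real.exp_le_exp.2 (mul_le_mul_of_nonneg_left ((le_abs_self _).trans (hWb σ t)) hlam))
  have h1 : ∀ σ : J → Bool, Real.exp (lam * ⨆ k, ∑ j, lab (σ j) * H.rule k (z j)) ≤
      ∫ t, Real.exp (lam * W σ t) ∂thresholdMeasure := fun σ => by
    have hle : (⨆ k, ∑ j, lab (σ j) * H.rule k (z j)) ≤ ∫ t, W σ t ∂thresholdMeasure := by
      refine ciSup_le fun k => ?_
      have hi : ∀ j, Integrable (fun t => lab (σ j) * thresholdSign t (H.rule k (z j)))
          thresholdMeasure := fun j =>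
        Integrable.of_bound ((measurable_thresholdSign _).const_mul _).aestronglyMeasurable 1
          (ae_of_all _ fun t => by
            rw [Real.norm_eq_abs, abs_mul, abs_lab, abs_thresholdSign, one_mul])
      have e : ∑ j, lab (σ j) * H.rule k (z j) =
          ∫ t, ∑ j, lab (σ j) * thresholdSign t (H.rule k (z j)) ∂thresholdMeasure := by
        rw [integral_finsetSum _ fun j _ => hi j]
        refine Finset.sum_congr rfl fun j _ => ?_
        rw [integral_const_mul, integral_thresholdSign (H.abs_rule_le k (z j))]
      rw [e]
      exact integral_mono (integrable_finsetSum _ fun j _ => hi j) (hWi σ) fun t =>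
        le_ciSup_finite (fun k => ∑ j, lab (σ j) * thresholdSign t (H.rule k (z j))) k
    refine (Real.exp_le_exp.2 (mul_le_mul_of_nonneg_left hle hlam)).trans ?_
    rw [← integral_const_mul]
    exact convexOn_exp.map_integral_le Real.continuous_exp.continuousOn isClosed_univ
      (ae_of_all _ fun _ => Set.mem_univ _) ((hWi σ).const_mul lam) (hEi σ)
  refine (Finset.sum_le_sum fun σ _ => h1 σ).trans ?_
  rw [← integral_finsetSum _ fun σ _ => hEi σ]
  have h2 := integral_mono (μ := thresholdMeasure) (integrable_finsetSum _ fun σ _ => hEi σ)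
    (integrable_const (2 ^ Fintype.card J * (N * Real.exp (lam ^ 2 * Fintype.card J / 2))))
    fun t => (sum_exp_iSup_thresholdSign_le H z lam t).trans (by
      gcongr
      exact hN t)
  simpa using h2

/-- A combination of base-rules in the unit ball of the `1`-norm is no more correlated with signs
than the best base-rule. -/
theorem sum_lab_mul_comb_le [Fintype J] [Nonempty (Fin T)]
    (H : BaseRules X T) (z : J → X)
    (σ : J → Bool) {ν : Fin T → ℝ} (hν : norm1 ν ≤ 1) :
    ∑ j, lab (σ j) * comb H ν (z j) ≤ ⨆ k, ∑ j, lab (σ j) * H.rule k (z j) := by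
  set W := ⨆ k, ∑ j, lab (σ j) * H.rule k (z j)
  have h1 : ∀ k, |∑ j, lab (σ j) * H.rule k (z j)| ≤ W := fun k => by
    refine abs_le'.2 ⟨le_ciSup_finite (fun k => ∑ j, lab (σ j) * H.rule k (z j)) k, ?_⟩
    obtain ⟨k', hk'⟩ := H.exists_neg k
    have := le_ciSup_finite (fun k => ∑ j, lab (σ j) * H.rule k (z j)) k'
    simpa only [hk', mul_neg, Finset.sum_neg_distrib] using this
  have hW : 0 ≤ W := (abs_nonneg _).trans (h1 (Classical.arbitrary _))
  have e : ∑ j, lab (σ j) * comb H ν (z j) = ∑ k, ν k * ∑ j, lab (σ j) * H.rule k (z j) := by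
    simp only [comb, Finset.mul_sum]
    rw [Finset.sum_comm]
    exact Finset.sum_congr rfl fun j _ => Finset.sum_congr rfl fun i _ => by ring
  rw [e]
  calc ∑ k, ν k * ∑ j, lab (σ j) * H.rule k (z j) ≤ ∑ k, |ν k| * W := by
        refine Finset.sum_le_sum fun k _ => (le_abs_self _).trans ?_
        rw [abs_mul]
        exact mul_le_mul_of_nonneg_left (h1 k) (abs_nonneg _)
    _ = norm1 ν * W := by rw [norm1, Finset.sum_mul]
    _ ≤ W := mul_le_of_le_one_left hW hν

theorem sum_exp_iSup_violation_le [Fintype J] [DecidableEq J] [Nonempty (Fin T)]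
    (H : BaseRules X T) (z : J → X)
    {lam : ℝ} (hlam : 0 ≤ lam) {N : ℝ} (hN : ∀ t, ((traces H z t).card : ℝ) ≤ N)
    (ν : ι → Fin T → ℝ) (hν : ∀ a, norm1 (ν a) ≤ 1) {θ : ℝ} (hθ : 0 ≤ θ) :
    ∑ σ : J → Bool, Real.exp (lam * ⨆ a, ∑ j, lab (σ j) * max (|comb H (ν a) (z j)| - θ) 0) ≤
      2 ^ Fintype.card J * (N * Real.exp (lam ^ 2 * Fintype.card J / 2)) := by
  refine (sum_exp_iSup_contraction hlam (φ := fun r => max (|r| - θ) 0) (fun a b => ?_) ?_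
    fun a j => comb H (ν a) (z j)).trans ((Finset.sum_le_sum fun σ _ => ?_).trans
      (sum_exp_iSup_rule_le H z hlam hN))
  · refine (abs_max_sub_max_le_abs _ _ _).trans ?_
    rw [sub_sub_sub_cancel_right]
    exact abs_abs_sub_abs_le _ _
  · simpa using hθ
  · exact Real.exp_le_exp.2 (mul_le_mul_of_nonneg_left
      (ciSup_le fun a => sum_lab_mul_comb_le H z σ (hν a)) hlam)

end RMBoost

namespace RMBoost

/-! ### Symmetrization with a sample of twice the size -/

section Symmetrization

variable {Ω ι : Type*} {f : ι → Ω → ℝ}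

theorem abs_sum_lab_mul_le {J : Type*} [Fintype J] (h0 : ∀ a x, 0 ≤ f a x) (h1 : ∀ a x, f a x ≤ 1)
    (σ : J → Bool) (z : J → Ω) (a : ι) :
    |∑ j, lab (σ j) * f a (z j)| ≤ Fintype.card J := by
  refine (Finset.abs_sum_le_sum_abs _ _).trans ?_
  have : ∀ j ∈ (Finset.univ : Finset J), |lab (σ j) * f a (z j)| ≤ 1 := fun j _ => by
    rw [abs_mul, abs_lab, one_mul, abs_of_nonneg (h0 _ _)]
    exact h1 _ _
  simpa using Finset.sum_le_card_nsmul _ _ _ this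

theorem integrable_exp_of_bounded {Z : Type*} [MeasurableSpace Z] (Q : Measure Z)
    [IsFiniteMeasure Q] {g : Z → ℝ} (hg : Measurable g) {B : ℝ} (hB : ∀ z, |g z| ≤ B) (lam : ℝ) :
    Integrable (fun z => Real.exp (lam * g z)) Q := by
  refine Integrable.of_bound (hg.const_mul lam).exp.aestronglyMeasurable (Real.exp (|lam| * B))
    (ae_of_all _ fun z => ?_)
  rw [Real.norm_eq_abs, Real.abs_exp]
  refine Real.exp_le_exp.2 ((le_abs_self _).trans ?_)
  rw [abs_mul]
  exact mul_le_mul_of_nonneg_left (hB z) (abs_nonneg _)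

variable [MeasurableSpace Ω] [Finite ι]

theorem measurable_iSup_sum_lab {J : Type*} [Fintype J] (hf : ∀ a, Measurable (f a))
    (σ : J → Bool) : Measurable fun z : J → Ω => ⨆ a, ∑ j, lab (σ j) * f a (z j) :=
  Measurable.iSup fun a => Finset.measurable_sum _ fun j _ =>
    ((hf a).comp (measurable_pi_apply j)).const_mul _

variable [Nonempty ι] {P : Measure Ω} [IsProbabilityMeasure P] {n : ℕ}

theorem iSup_abs_le {v : ι → ℝ} {B : ℝ} (h : ∀ a, |v a| ≤ B) : |⨆ a, v a| ≤ B := by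
  obtain ⟨a, ha⟩ := exists_eq_ciSup_of_finite (f := v)
  rw [← ha]
  exact h a

/-- Jensen's inequality for a ghost sample, with the signs `+` on the ghost sample (the first half
of the double sample) and `-` on the sample. -/
theorem exp_integral_iSup_le (hf : ∀ a, Measurable (f a)) (h0 : ∀ a x, 0 ≤ f a x)
    (h1 : ∀ a x, f a x ≤ 1) {lam : ℝ} (hlam : 0 ≤ lam) :
    Real.exp (lam * ∫ x, ⨆ a, ∑ i, (∫ y, f a y ∂P - f a (x i)) ∂(Measure.pi fun _ : Fin n => P)) ≤
      ∫ z, Real.exp (lam * ⨆ a, ∑ j, lab (Sum.elim (fun _ => true) (fun _ => false) j) * f a (z j))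
        ∂(Measure.pi fun _ : Fin n ⊕ Fin n => P) := by
  set Q : Measure (Fin n → Ω) := Measure.pi fun _ : Fin n => P with hQ
  set σ : Fin n ⊕ Fin n → Bool := Sum.elim (fun _ => true) (fun _ => false) with hσ
  set D : (Fin n ⊕ Fin n → Ω) → ℝ := fun z => ⨆ a, ∑ j, lab (σ j) * f a (z j) with hD
  have hDm : Measurable D := measurable_iSup_sum_lab hf σ
  have hDb : ∀ z, |D z| ≤ Fintype.card (Fin n ⊕ Fin n) := fun z =>
    iSup_abs_le fun a => abs_sum_lab_mul_le h0 h1 σ z a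
  have hDi : Integrable D (Measure.pi fun _ : Fin n ⊕ Fin n => P) :=
    Integrable.of_bound hDm.aestronglyMeasurable _ (ae_of_all _ hDb)
  have hJ : Real.exp (lam * ∫ z, D z ∂(Measure.pi fun _ : Fin n ⊕ Fin n => P)) ≤
      ∫ z, Real.exp (lam * D z) ∂(Measure.pi fun _ : Fin n ⊕ Fin n => P) := by
    rw [← integral_const_mul]
    exact convexOn_exp.map_integral_le Real.continuous_exp.continuousOn isClosed_univ
      (ae_of_all _ fun _ => Set.mem_univ _) (hDi.const_mul lam)
      (integrable_exp_of_bounded _ hDm hDb lam)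
  refine le_trans (Real.exp_le_exp.2 (mul_le_mul_of_nonneg_left ?_ hlam)) hJ
  have mp := measurePreserving_sumPiEquivProdPi (fun _ : Fin n ⊕ Fin n => P)
  set e := MeasurableEquiv.sumPiEquivProdPi (fun _ : Fin n ⊕ Fin n => Ω) with he
  set D' : (Fin n → Ω) × (Fin n → Ω) → ℝ :=
    fun q => ⨆ a, (∑ i, f a (q.1 i) - ∑ i, f a (q.2 i)) with hD'
  have hDe : ∀ z, D z = D' (e z) := fun z => by
    simp only [hD, hD', hσ, Fintype.sum_sum_type, Sum.elim_inl, Sum.elim_inr, lab, if_true,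
      Bool.false_eq_true, if_false, one_mul, neg_one_mul, Finset.sum_neg_distrib,
      ← sub_eq_add_neg]
    rfl
  have hs : ∀ a, Measurable fun x : Fin n → Ω => ∑ i, f a (x i) := fun a =>
    Finset.measurable_sum _ fun i _ => (hf a).comp (measurable_pi_apply i)
  have hD'm : Measurable D' := Measurable.iSup fun a =>
    ((hs a).comp measurable_fst).sub ((hs a).comp measurable_snd)
  have hsb : ∀ a (x : Fin n → Ω), 0 ≤ ∑ i, f a (x i) ∧ ∑ i, f a (x i) ≤ n := fun a x =>
    ⟨Finset.sum_nonneg fun i _ => h0 _ _, by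
      simpa using Finset.sum_le_card_nsmul Finset.univ _ 1 fun i _ => h1 a (x i)⟩
  have hD'b : ∀ q, |D' q| ≤ n := fun q => iSup_abs_le fun a => abs_le.2 (by
    have := hsb a q.1
    have := hsb a q.2
    constructor <;> linarith)
  have hD'i : Integrable D' (Q.prod Q) :=
    Integrable.of_bound hD'm.aestronglyMeasurable _ (ae_of_all _ hD'b)
  have hsi : ∀ a, Integrable (fun x : Fin n → Ω => ∑ i, f a (x i)) Q := fun a =>
    Integrable.of_bound (hs a).aestronglyMeasurable n (ae_of_all _ fun x => by
      rw [Real.norm_eq_abs, abs_of_nonneg (hsb a x).1]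
      exact (hsb a x).2)
  have hint : ∀ a, ∫ x, ∑ i, f a (x i) ∂Q = ∑ _i : Fin n, ∫ y, f a y ∂P := fun a => by
    rw [integral_finsetSum]
    · refine Finset.sum_congr rfl fun i _ => ?_
      exact (measurePreserving_eval (fun _ : Fin n => P) i).map_eq ▸
        (integral_map (measurable_pi_apply i).aemeasurable
          (hf a).aestronglyMeasurable).symm
    · exact fun i _ => Integrable.of_bound
        ((hf a).comp (measurable_pi_apply i)).aestronglyMeasurable 1 (ae_of_all _ fun x => by
          rw [Real.norm_eq_abs, abs_of_nonneg (h0 _ _)]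
          exact h1 _ _)
  simp_rw [hDe]
  rw [mp.integral_comp' (g := D'), integral_prod_symm _ hD'i]
  refine integral_mono ?_ hD'i.integral_prod_right fun x => ?_
  · have hfb : ∀ a, 0 ≤ ∫ y, f a y ∂P ∧ ∫ y, f a y ∂P ≤ 1 := fun a =>
      ⟨integral_nonneg (h0 a), by
        have := integral_mono_of_nonneg (μ := P) (ae_of_all _ (h0 a)) (integrable_const (1 : ℝ))
          (ae_of_all _ (h1 a))
        simpa using this⟩
    refine Integrable.of_bound (Measurable.iSup fun a => Finset.measurable_sum _ fun i _ =>
      measurable_const.sub ((hf a).comp (measurable_pi_apply i))).aestronglyMeasurable n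
        (ae_of_all _ fun x => iSup_abs_le fun a => (Finset.abs_sum_le_sum_abs _ _).trans ?_)
    simpa using Finset.sum_le_card_nsmul Finset.univ (fun i => |∫ y, f a y ∂P - f a (x i)|) 1
      fun i _ => abs_le.2 (by
        constructor <;> linarith [h0 a (x i), h1 a (x i), (hfb a).1, (hfb a).2])
  · refine ciSup_le fun a => ?_
    rw [Finset.sum_sub_distrib, ← hint a]
    have e1 : ∫ x', ∑ i, f a (x' i) ∂Q - ∑ i, f a (x i) =
        ∫ x', (∑ i, f a (x' i) - ∑ i, f a (x i)) ∂Q := by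
      rw [integral_sub (hsi a) (integrable_const _)]
      simp
    rw [e1]
    refine integral_mono ((hsi a).sub (integrable_const _)) ?_ fun x' =>
      le_ciSup_finite (fun a => ∑ i, f a (x' i) - ∑ i, f a (x i)) a
    exact Integrable.of_bound (hD'm.comp measurable_prodMk_right).aestronglyMeasurable n
      (ae_of_all _ fun x' => hD'b (x', x))

/-- If at most half of the signs are negative, they can be moved to places in the second half of
the double sample; the signs of the remaining places there only increase as `f ≥ 0`. -/
theorem integral_exp_iSup_le_of_card_le (hf : ∀ a, Measurable (f a)) (h0 : ∀ a x, 0 ≤ f a x)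
    (h1 : ∀ a x, f a x ≤ 1) {lam : ℝ} (hlam : 0 ≤ lam) (σ : Fin n ⊕ Fin n → Bool)
    (hσ : (Finset.univ.filter fun j => σ j = false).card ≤ n) :
    ∫ z, Real.exp (lam * ⨆ a, ∑ j, lab (Sum.elim (fun _ => true) (fun _ => false) j) * f a (z j))
        ∂(Measure.pi fun _ : Fin n ⊕ Fin n => P) ≤
      ∫ z, Real.exp (lam * ⨆ a, ∑ j, lab (σ j) * f a (z j))
        ∂(Measure.pi fun _ : Fin n ⊕ Fin n => P) := by
  obtain ⟨A, hA, hcard⟩ := Finset.exists_subset_card_eq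
    (s := (Finset.univ : Finset (Fin n)).map Function.Embedding.inr)
    (n := (Finset.univ.filter fun j => σ j = false).card) (by simpa using hσ)
  set E : Equiv.Perm (Fin n ⊕ Fin n) :=
    (Finset.equivOfCardEq hcard.symm).extendSubtype with hE
  have hEm : ∀ j, σ j = false → ∃ i, E j = Sum.inr i := fun j hj => by
    have h := Equiv.extendSubtype_mem (Finset.equivOfCardEq hcard.symm) j
      (Finset.mem_filter.2 ⟨Finset.mem_univ j, hj⟩)
    obtain ⟨i, _, hi⟩ := Finset.mem_map.1 (hA h)
    exact ⟨i, hi.symm⟩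
  have mp := measurePreserving_piCongrLeft (fun _ : Fin n ⊕ Fin n => P) E.symm
  have hpc : ∀ (z : Fin n ⊕ Fin n → Ω) j,
      MeasurableEquiv.piCongrLeft (fun _ : Fin n ⊕ Fin n => Ω) E.symm z j = z (E j) :=
    fun z j => by
      have := Equiv.piCongrLeft_apply_apply (fun _ : Fin n ⊕ Fin n => Ω) E.symm z (E j)
      rwa [E.symm_apply_apply] at this
  rw [← mp.integral_comp' (g := fun z => Real.exp (lam * ⨆ a, ∑ j, lab (σ j) * f a (z j)))]
  have hm := (measurable_iSup_sum_lab (Ω := Ω) hf σ).comp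
    (MeasurableEquiv.piCongrLeft (fun _ : Fin n ⊕ Fin n => Ω) E.symm).measurable
  refine integral_mono
    (integrable_exp_of_bounded _ (measurable_iSup_sum_lab hf _)
      (fun z => iSup_abs_le fun a => abs_sum_lab_mul_le h0 h1 _ z a) lam)
    (integrable_exp_of_bounded _ hm
      (fun z => iSup_abs_le fun a => abs_sum_lab_mul_le h0 h1 _ _ a) lam) fun z => ?_
  refine Real.exp_le_exp.2 (mul_le_mul_of_nonneg_left (ciSup_mono (Set.finite_range _).bddAbove
    fun a => ?_) hlam)
  simp only [hpc]
  rw [← Equiv.sum_comp E]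
  refine Finset.sum_le_sum fun j _ => mul_le_mul_of_nonneg_right ?_ (h0 _ _)
  cases hj : σ j with
  | false =>
    obtain ⟨i, hi⟩ := hEm j hj
    rw [hi, Sum.elim_inr]
  | true => exact (le_abs_self _).trans (abs_lab_le _)

/-- Symmetrization for non-negative functions. Compared with the usual inequality, the Rademacher
process is that of `2 n` points instead of `n` but is not doubled, which saves a factor `√2` in the
resulting deviation bounds. -/
theorem exp_integral_iSup_le_of_rademacher (hf : ∀ a, Measurable (f a)) (h0 : ∀ a x, 0 ≤ f a x)
    (h1 : ∀ a x, f a x ≤ 1) {lam : ℝ} (hlam : 0 ≤ lam) {M : ℝ}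
    (hM : ∀ z : Fin n ⊕ Fin n → Ω, ∑ σ : Fin n ⊕ Fin n → Bool,
      Real.exp (lam * ⨆ a, ∑ j, lab (σ j) * f a (z j)) ≤ 2 ^ Fintype.card (Fin n ⊕ Fin n) * M) :
    Real.exp (lam * ∫ x, ⨆ a, ∑ i, (∫ y, f a y ∂P - f a (x i)) ∂(Measure.pi fun _ : Fin n => P)) ≤
      2 * M := by
  refine (exp_integral_iSup_le hf h0 h1 hlam).trans ?_
  set I := ∫ z, Real.exp
    (lam * ⨆ a, ∑ j, lab (Sum.elim (fun _ => true) (fun _ => false) j) * f a (z j))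
      ∂(Measure.pi fun _ : Fin n ⊕ Fin n => P)
  set Ψ : (Fin n ⊕ Fin n → Bool) → ℝ := fun σ =>
    ∫ z, Real.exp (lam * ⨆ a, ∑ j, lab (σ j) * f a (z j)) ∂(Measure.pi fun _ : Fin n ⊕ Fin n => P)
    with hΨ
  have hi : ∀ σ : Fin n ⊕ Fin n → Bool, Integrable
      (fun z : Fin n ⊕ Fin n → Ω => Real.exp (lam * ⨆ a, ∑ j, lab (σ j) * f a (z j)))
      (Measure.pi fun _ : Fin n ⊕ Fin n => P) := fun σ =>
    integrable_exp_of_bounded _ (measurable_iSup_sum_lab hf _)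
      (fun z => iSup_abs_le fun a => abs_sum_lab_mul_le h0 h1 _ z a) lam
  have hpos : ∀ σ, 0 ≤ Ψ σ := fun σ => integral_nonneg fun z => (Real.exp_pos _).le
  -- a sign vector or its opposite has at most `n` negative signs
  have hpair : ∀ σ, I ≤ Ψ σ + Ψ fun j => !σ j := fun σ => by
    rcases le_total (Finset.univ.filter fun j => σ j = false).card n with h | h
    · exact (integral_exp_iSup_le_of_card_le hf h0 h1 hlam σ h).trans
        (le_add_of_nonneg_right (hpos _))
    · refine (integral_exp_iSup_le_of_card_le hf h0 h1 hlam (fun j => !σ j) ?_).trans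
        (le_add_of_nonneg_left (hpos _))
      have hc := Finset.card_filter_add_card_filter_not (s := Finset.univ) fun j => σ j = false
      rw [Finset.card_univ, Fintype.card_sum, Fintype.card_fin] at hc
      have e : (Finset.univ.filter fun j => (!σ j) = false) =
          Finset.univ.filter fun j => ¬ σ j = false := by
        ext j
        cases σ j <;> simp
      rw [e]
      omega
  have hflip : ∑ σ : Fin n ⊕ Fin n → Bool, Ψ (fun j => !σ j) = ∑ σ, Ψ σ := by
    have hinv : Function.Involutive fun (σ : Fin n ⊕ Fin n → Bool) j => !σ j := fun σ => by
      funext j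
      simp
    exact Equiv.sum_comp hinv.toPerm Ψ
  have hsum : ∑ σ, Ψ σ ≤ 2 ^ Fintype.card (Fin n ⊕ Fin n) * M := by
    simp only [hΨ]
    rw [← integral_finsetSum _ fun σ _ => hi σ]
    have := integral_mono (integrable_finsetSum _ fun σ _ => hi σ)
      (integrable_const (μ := Measure.pi fun _ : Fin n ⊕ Fin n => P) _) hM
    simpa using this
  have h2 := Finset.card_nsmul_le_sum Finset.univ _ I fun σ _ => hpair σ
  rw [Finset.sum_add_distrib, hflip, Finset.card_univ, Fintype.card_fun, Fintype.card_bool,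
    nsmul_eq_mul] at h2
  push_cast at h2
  have hp : (0 : ℝ) < 2 ^ Fintype.card (Fin n ⊕ Fin n) := by positivity
  refine le_of_mul_le_mul_left ?_ hp
  linarith

end Symmetrization

end RMBoost

namespace RMBoost

variable {X : Type*} [MeasurableSpace X] {T n : ℕ}

/-! ### Numerical inequalities -/

theorem exp_div_le {p q : ℕ} (hq : q ≠ 0) {b : ℝ} (hb : 0 ≤ b)
    (h : (2.7182818286 : ℝ) ^ p ≤ b ^ q) : Real.exp (p / q) ≤ b := by
  have hq' : (q : ℝ) ≠ 0 := by exact_mod_cast hq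
  refine (pow_le_pow_iff_left₀ (Real.exp_pos _).le hb hq).1 ?_
  rw [← Real.exp_nat_mul, mul_div_cancel₀ _ hq', ← Real.exp_one_pow]
  exact (pow_le_pow_left₀ (Real.exp_pos _).le Real.exp_one_lt_d9.le p).trans h

theorem le_exp_div {p q : ℕ} (hq : q ≠ 0) {b : ℝ} (hb : 0 ≤ b)
    (h : b ^ q ≤ (2.7182818283 : ℝ) ^ p) : b ≤ Real.exp (p / q) := by
  have hq' : (q : ℝ) ≠ 0 := by exact_mod_cast hq
  refine (pow_le_pow_iff_left₀ hb (Real.exp_pos _).le hq).1 ?_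
  rw [← Real.exp_nat_mul, mul_div_cancel₀ _ hq', ← Real.exp_one_pow]
  exact h.trans (pow_le_pow_left₀ (by norm_num) Real.exp_one_gt_d9.le p)

/-- A convex function below a line at the end points of an interval is below it in between. -/
theorem exp_affine_le {a b c l u x : ℝ} (hlu : l < u) (hl : Real.exp (a * l + b) ≤ c * l)
    (hu : Real.exp (a * u + b) ≤ c * u) (hx : l ≤ x) (hx' : x ≤ u) :
    Real.exp (a * x + b) ≤ c * x := by
  have hd : 0 < u - l := sub_pos.2 hlu
  have h := convexOn_exp.2 (Set.mem_univ (a * l + b)) (Set.mem_univ (a * u + b))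
    (div_nonneg (sub_nonneg.2 hx') hd.le) (div_nonneg (sub_nonneg.2 hx) hd.le)
    (by field_simp; ring)
  simp only [smul_eq_mul] at h
  have e1 : (u - x) / (u - l) * (a * l + b) + (x - l) / (u - l) * (a * u + b) = a * x + b := by
    field_simp
    ring
  have e2 : (u - x) / (u - l) * (c * l) + (x - l) / (u - l) * (c * u) = c * x := by
    field_simp
    ring
  rw [e1] at h
  rw [← e2]
  refine h.trans (add_le_add (mul_le_mul_of_nonneg_left hl ?_) (mul_le_mul_of_nonneg_left hu ?_))
  · exact div_nonneg (sub_nonneg.2 hx') hd.le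
  · exact div_nonneg (sub_nonneg.2 hx) hd.le

/-- The values of `L` with `g < 1`, where `g ^ 2 = 24 * L * exp (-L)`. -/
theorem lt_of_mul_lt_exp {L : ℝ} (hL : 1 ≤ L) (h : 24 * L < Real.exp L) : 4.7 < L := by
  by_contra! hL'
  have h1 : Real.exp (1 * 1 + 0) ≤ 24 * 1 := by
    have := Real.exp_one_lt_d9
    norm_num at this ⊢
    linarith
  have h2 : Real.exp (1 * 4.7 + 0) ≤ 24 * 4.7 := by
    have := exp_div_le (p := 47) (q := 10) (b := 24 * 4.7) (by norm_num) (by norm_num)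
      (by norm_num)
    norm_num at this ⊢
    exact this
  have h3 := exp_affine_le (by norm_num) h1 h2 hL hL'
  rw [one_mul, add_zero] at h3
  linarith

/-- The number of points of the grid of constraint levels, in terms of `g ^ 2 = 24 * L * exp (-L)`.
For large `L` the two sides grow like `exp (L / 2)` and `exp (0.81 * L)`. -/
theorem grid_card_le_exp {g L : ℝ} (hg : 0 < g) (hL : 4.7 ≤ L) (h : g ^ 2 * Real.exp L = 24 * L) :
    20 / g - 19 ≤ Real.exp (0.81 * L - 2.09) := by
  have hL0 : 0 < L := by linarith
  rcases le_total L 7 with h7 | h7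
  · -- `(20 / g) ^ 2 ≤ 4 * 19 * exp u ≤ (19 + exp u) ^ 2`
    set E := Real.exp (0.81 * L - 2.09) with hE
    have hEpos : 0 < E := Real.exp_pos _
    have h1 : Real.exp (0.19 * L + 2.09) ≤ 4.56 * L := by
      refine exp_affine_le (l := 4.7) (u := 7) (by norm_num) ?_ ?_ hL h7
      · have := exp_div_le (p := 3) (q := 1) (b := 4.56 * 4.7) (by norm_num) (by norm_num)
          (by norm_num)
        exact (Real.exp_le_exp.2 (by norm_num)).trans this
      · have := exp_div_le (p := 171) (q := 50) (b := 4.56 * 7) (by norm_num) (by norm_num)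
          (by norm_num)
        norm_num at this ⊢
        exact this
    have h2 : Real.exp L = Real.exp (0.19 * L + 2.09) * E := by
      rw [hE, ← Real.exp_add]
      congr 1
      ring
    have h3 : 24 * L ≤ g ^ 2 * (4.56 * L * E) := by
      rw [← h, h2]
      exact mul_le_mul_of_nonneg_left (mul_le_mul_of_nonneg_right h1 hEpos.le) (sq_nonneg g)
    have h4 : 400 ≤ g ^ 2 * (76 * E) := by
      have : L * 24 ≤ L * (g ^ 2 * (4.56 * E)) := by linarith
      have := le_of_mul_le_mul_left this hL0
      linarith
    have h5 : (20 : ℝ) ^ 2 ≤ (g * (19 + E)) ^ 2 := by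
      rw [mul_pow]
      have := mul_le_mul_of_nonneg_left
        (show 76 * E ≤ (19 + E) ^ 2 by nlinarith [sq_nonneg (19 - E)]) (sq_nonneg g)
      linarith
    have h6 : 20 ≤ g * (19 + E) := le_of_sq_le_sq h5 (by positivity)
    rw [sub_le_iff_le_add, div_le_iff₀ hg]
    linarith
  · set v := (L - 7) / 2 with hv
    have hv0 : 0 ≤ v := by
      rw [hv]
      linarith
    set E := Real.exp v with hE
    have hE1 : 1 ≤ E := Real.one_le_exp hv0
    have e1 : Real.exp (0.81 * L - 2.09) = Real.exp 3.58 * E ^ (1.62 : ℝ) := by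
      rw [hE, ← Real.exp_mul, ← Real.exp_add, hv]
      congr 1
      ring
    have h1 : 1 + 1.62 * (E - 1) ≤ E ^ (1.62 : ℝ) := by
      have := one_add_mul_self_le_rpow_one_add (s := E - 1) (by linarith) (p := 1.62) (by norm_num)
      rwa [add_sub_cancel] at this
    have h2 : 35.8 ≤ Real.exp 3.58 := by
      have := le_exp_div (p := 179) (q := 50) (b := 35.8) (by norm_num) (by norm_num) (by norm_num)
      norm_num at this ⊢
      exact this
    have h3 : Real.exp 3.5 ≤ 33.12 := by
      have := exp_div_le (p := 7) (q := 2) (b := 33.12) (by norm_num) (by norm_num) (by norm_num)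
      norm_num at this ⊢
      exact this
    have e2 : Real.exp L = (Real.exp 3.5 * E) ^ 2 := by
      rw [hE, ← Real.exp_add, ← Real.exp_nat_mul, hv]
      congr 1
      push_cast
      ring
    have h4 : (12.96 : ℝ) ^ 2 ≤ (g * (Real.exp 3.5 * E)) ^ 2 := by
      rw [mul_pow, ← e2, h]
      linarith
    have h5 : 12.96 ≤ g * (Real.exp 3.5 * E) := le_of_sq_le_sq h4 (by positivity)
    have h6 : 12.96 ≤ g * (33.12 * E) := h5.trans (by gcongr)
    have h7 : 20 / g ≤ 51.12 * E := by
      rw [div_le_iff₀ hg]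
      linarith
    rw [e1]
    have h8 : 35.8 * (1 + 1.62 * (E - 1)) ≤ Real.exp 3.58 * E ^ (1.62 : ℝ) :=
      mul_le_mul h2 h1 (by linarith) (Real.exp_pos _).le
    linarith

/-- The ratio of the bound for the expected deviation to the term `g` of the error bound, as a
function of `L = log (3 n / D)`. -/
noncomputable def meanRatio (L : ℝ) : ℝ := (L + 1.288) / (3.12 * L) + 0.39

theorem meanRatio_le {L : ℝ} (hL : 4.7 ≤ L) : meanRatio L ≤ 0.95 := by
  have : (L + 1.288) / (3.12 * L) ≤ 0.56 := by
    rw [div_le_iff₀ (by linarith)]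
    linarith
  rw [meanRatio]
  linarith

/-- The exponent in the bound for one constraint level, for VC-dimension one. -/
theorem exponent_ge {L : ℝ} (hL : 4.7 ≤ L) :
    0.81 * L - 2.09 ≤ 16 * L * (0.95 - meanRatio L) ^ 2 := by
  have hL0 : 0 < L := by linarith
  have e : (0.95 - meanRatio L) * L = 0.56 * L - (L + 1.288) / 3.12 := by
    rw [meanRatio]
    field_simp
    ring
  refine le_of_mul_le_mul_left ?_ hL0
  have e2 : L * (16 * L * (0.95 - meanRatio L) ^ 2) = 16 * ((0.95 - meanRatio L) * L) ^ 2 := by ring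
  rw [e2, e]
  -- the discriminant of the difference of the two sides is negative
  ring_nf
  nlinarith [sq_nonneg (L - 4.987)]

/-! ### Deviations for a finite family and a fixed constraint level -/

theorem nonempty_of_vcDim {H : BaseRules X T} (hD : 1 ≤ vcDim H) : Nonempty (Fin T) := by
  have hne : {d | ∃ s : Finset (X × ℝ), s.card = d ∧ SubgraphShatters H s}.Nonempty := by
    by_contra h
    rw [Set.not_nonempty_iff_eq_empty] at h
    simp [vcDim, h] at hD
  obtain ⟨_, s, _, hs⟩ := hne
  exact (hs ∅ (Finset.empty_subset _)).nonempty

/-- As the base-rules are closed under negation, a value `ħ(x) ≠ 0` shatters the point `(x, 0)`. -/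
theorem rule_eq_zero_of_vcDim {H : BaseRules X T} (hD : vcDim H = 0) (j : Fin T) (x : X) :
    H.rule j x = 0 := by
  by_contra hne
  obtain ⟨j', hj'⟩ := H.exists_neg j
  obtain ⟨a, b, ha, hb⟩ : ∃ a b, 0 < H.rule a x ∧ H.rule b x < 0 := by
    rcases lt_or_gt_of_ne hne with h | h
    · exact ⟨j', j, by rw [hj']; linarith, h⟩
    · exact ⟨j, j', h, by rw [hj']; linarith⟩
  have hs : SubgraphShatters H {(x, (0 : ℝ))} := fun A hA => by
    rcases Finset.subset_singleton_iff.1 hA with rfl | rfl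
    · exact ⟨b, fun z hz => by
        rw [Finset.mem_singleton.1 hz]
        simpa using hb.le⟩
    · exact ⟨a, fun z hz => by
        rw [Finset.mem_singleton.1 hz]
        simpa using ha⟩
  have := card_le_of_subgraphShatters hs
  rw [Finset.card_singleton, hD] at this
  omega

theorem log_two_mul_growth_le {D n : ℕ} (hD : 1 ≤ D) (hn : D ≤ n) :
    Real.log (2 * (Real.exp 1 * (2 * n) / D) ^ D) ≤ D * (Real.log (3 * n / D) + 1.288) := by
  have hD0 : (0 : ℝ) < D := by exact_mod_cast hD
  have hn0 : (0 : ℝ) < n := by exact_mod_cast hD.trans hn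
  have h1 : 2 * (Real.exp 1 * (2 * n) / D) ^ D ≤ (3 * n / D * (Real.exp 1 * (4 / 3))) ^ D := by
    have e : 3 * n / D * (Real.exp 1 * (4 / 3)) = 2 * (Real.exp 1 * (2 * n) / D) := by ring
    rw [e, mul_pow]
    refine mul_le_mul_of_nonneg_right ?_ (by positivity)
    exact le_self_pow₀ (by norm_num) (by omega)
  have h2 : (4 / 3 : ℝ) ≤ Real.exp 0.288 := by
    have := le_exp_div (p := 36) (q := 125) (b := 4 / 3) (by norm_num) (by norm_num) (by norm_num)
    norm_num at this ⊢
    exact this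
  have h3 : Real.exp 1 * (4 / 3) ≤ Real.exp 1.288 := by
    rw [show (1.288 : ℝ) = 1 + 0.288 by norm_num, Real.exp_add]
    exact mul_le_mul_of_nonneg_left h2 (Real.exp_pos _).le
  refine (Real.log_le_log (by positivity) h1).trans ?_
  rw [Real.log_pow]
  refine mul_le_mul_of_nonneg_left ?_ hD0.le
  rw [Real.log_mul (by positivity) (by positivity)]
  have := Real.log_le_log (by positivity) h3
  rw [Real.log_exp] at this
  linarith

theorem max_sub_le_of_norm1_le (H : BaseRules X T) {ν : Fin T → ℝ} (hν : norm1 ν ≤ 1) {θ : ℝ}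
    (hθ1 : θ ≤ 1) (x : X) : max (|comb H ν x| - θ) 0 ≤ 1 - θ :=
  max_le (by linarith [abs_comb_le H ν x]) (by linarith)

/-- The expectation of the largest deviation is at most `meanRatio L * g`, where `g` is
`2 * √(2 D L / n)` with `D` the VC-dimension. -/
theorem integral_deviation_le {ι : Type*} [Finite ι] [Nonempty ι] (q : Measure (X × Bool))
    [IsProbabilityMeasure q] (H : BaseRules X T) (hD : 1 ≤ vcDim H) (hn : vcDim H ≤ n)
    {g : ℝ} (hg : 0 < g) (hg2 : g ^ 2 * n = 8 * vcDim H * Real.log (3 * n / vcDim H))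
    (ν : ι → Fin T → ℝ) (hν : ∀ a, norm1 (ν a) ≤ 1) {θ : ℝ} (hθ : 0 ≤ θ) :
    ∫ S, ⨆ a, ∑ i, (∫ z, max (|comb H (ν a) z.1| - θ) 0 ∂q - max (|comb H (ν a) (S i).1| - θ) 0)
        ∂(Measure.pi fun _ : Fin n => q) ≤
      n * (meanRatio (Real.log (3 * n / vcDim H)) * g) := by
  have := nonempty_of_vcDim hD
  set D := vcDim H with hDdef
  set L := Real.log (3 * n / D) with hL
  have hD0 : (0 : ℝ) < D := by exact_mod_cast hD
  have hn0 : (0 : ℝ) < n := by exact_mod_cast hD.trans hn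
  have hL0 : 0 < L := by
    have : 0 < 8 * D * L := hg2 ▸ by positivity
    exact pos_of_mul_pos_right this (by positivity)
  set N : ℝ := (Real.exp 1 * (2 * n) / D) ^ D with hN
  have hcard : Fintype.card (Fin n ⊕ Fin n) = 2 * n := by
    rw [Fintype.card_sum, Fintype.card_fin, two_mul]
  have htr : ∀ (z : Fin n ⊕ Fin n → X) (t : ℝ), ((traces H z t).card : ℝ) ≤ N := fun z t => by
    have h1 : ((traces H z t).card : ℝ) ≤ ((∑ k ∈ Finset.Iic D, (2 * n).choose k : ℕ) : ℝ) := by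
      rw [← hcard]
      exact_mod_cast card_traces_le H z t
    have h2 := sum_choose_le (m := 2 * n) hD (by omega)
    push_cast at h1 h2
    exact h1.trans h2
  -- `0.39 * g` is close to the parameter `g * √((L + 1.288) / (8 * L))` that minimizes the bound
  have hl0 : 0 < 0.39 * g := by positivity
  set f : ι → X × Bool → ℝ := fun a z => max (|comb H (ν a) z.1| - θ) 0 with hf
  have hM : ∀ z : Fin n ⊕ Fin n → X × Bool, ∑ σ : Fin n ⊕ Fin n → Bool,
      Real.exp (0.39 * g * ⨆ a, ∑ j, lab (σ j) * f a (z j)) ≤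
        2 ^ Fintype.card (Fin n ⊕ Fin n) * (N * Real.exp ((0.39 * g) ^ 2 * n)) := fun z => by
    have e : (0.39 * g) ^ 2 * n = (0.39 * g) ^ 2 * Fintype.card (Fin n ⊕ Fin n) / 2 := by
      rw [hcard]
      push_cast
      ring
    rw [e]
    exact sum_exp_iSup_violation_le H (fun j => (z j).1) hl0.le (htr _) ν hν hθ
  set m := ∫ S, ⨆ a, ∑ i, (∫ z, f a z ∂q - f a (S i)) ∂(Measure.pi fun _ : Fin n => q)
    with hm
  have h1 : Real.exp (0.39 * g * m) ≤ 2 * (N * Real.exp ((0.39 * g) ^ 2 * n)) :=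
    exp_integral_iSup_le_of_rademacher
      (fun a => (measurable_violation H (ν a) θ).comp measurable_fst)
      (fun a z => le_max_right _ _)
      (fun a z => max_le (by linarith [abs_comb_le H (ν a) z.1, hν a]) zero_le_one) hl0.le hM
  have hNpos : 0 < N := by positivity
  have h2 := Real.log_le_log (Real.exp_pos _) h1
  rw [Real.log_exp, ← mul_assoc, Real.log_mul (by positivity) (Real.exp_pos _).ne', Real.log_exp]
    at h2
  have h3 : 0.39 * g * m ≤ D * (L + 1.288) + (0.39 * g) ^ 2 * n :=
    h2.trans (add_le_add (log_two_mul_growth_le hD hn) le_rfl)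
  refine le_of_mul_le_mul_left (h3.trans (le_of_eq ?_)) hl0
  have e : 0.39 * g * (n * (meanRatio L * g)) = 0.39 * (g ^ 2 * n) * meanRatio L := by ring
  have e2 : (0.39 * g) ^ 2 * n = 0.39 * 0.39 * (g ^ 2 * n) := by ring
  rw [e, e2, hg2, meanRatio]
  field_simp
  ring

/-- McDiarmid's inequality for the largest deviation; the functions have range `[0, 1 - θ]`. -/
theorem measureReal_deviation_le {ι : Type*} [Finite ι] [Nonempty ι] (q : Measure (X × Bool))
    [IsProbabilityMeasure q] (H : BaseRules X T) (hD : 1 ≤ vcDim H) (hn : vcDim H ≤ n)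
    {g : ℝ} (hg : 0 < g) (hg2 : g ^ 2 * n = 8 * vcDim H * Real.log (3 * n / vcDim H))
    (ν : ι → Fin T → ℝ) (hν : ∀ a, norm1 (ν a) ≤ 1) {θ : ℝ} (hθ : 0 ≤ θ) (hθ1 : θ < 1)
    {τ : ℝ} (hτ : 0 ≤ τ) :
    (Measure.pi fun _ : Fin n => q).real {S | ∃ a,
        n * (meanRatio (Real.log (3 * n / vcDim H)) * g + (1 - θ) * τ) ≤
          ∑ i, (∫ z, max (|comb H (ν a) z.1| - θ) 0 ∂q - max (|comb H (ν a) (S i).1| - θ) 0)} ≤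
      Real.exp (-2 * n * τ ^ 2) := by
  have hn0 : (0 : ℝ) < n := by exact_mod_cast hD.trans hn
  have hθ0 : 0 < 1 - θ := by linarith
  set f : ι → X × Bool → ℝ := fun a z => max (|comb H (ν a) z.1| - θ) 0 with hf
  have hfm : ∀ a, Measurable (f a) := fun a =>
    (measurable_violation H (ν a) θ).comp measurable_fst
  have hf0 : ∀ a z, 0 ≤ f a z := fun a z => le_max_right _ _
  have hf1 : ∀ a z, f a z ≤ 1 - θ := fun a z => max_sub_le_of_norm1_le H (hν a) hθ1.le z.1
  have hfi : ∀ a, 0 ≤ ∫ z, f a z ∂q ∧ ∫ z, f a z ∂q ≤ 1 - θ := fun a =>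
    ⟨integral_nonneg (hf0 a), by
      have := integral_mono_of_nonneg (μ := q) (ae_of_all _ (hf0 a)) (integrable_const (1 - θ))
        (ae_of_all _ (hf1 a))
      simpa using this⟩
  have hG := measureReal_pi_le_of_bounded_differences q (c := 1 - θ) (B := n * (1 - θ)) hθ0.le
    (n := n) (G := fun S => ⨆ a, ∑ i, (∫ z, f a z ∂q - f a (S i))) (Measurable.iSup fun a =>
      Finset.measurable_sum _ fun i _ => measurable_const.sub
        ((hfm a).comp (measurable_pi_apply i))) (fun S => iSup_abs_le fun a => ?_)
    (fun S i y => ciSup_le fun a => ?_) (t := n * ((1 - θ) * τ)) (by positivity)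
  · have hexp : -2 * (n * ((1 - θ) * τ)) ^ 2 / (n * (1 - θ) ^ 2) = -2 * n * τ ^ 2 := by
      field_simp
    rw [hexp] at hG
    refine (measureReal_mono fun S hS => ?_).trans hG
    obtain ⟨a, ha⟩ := hS
    have h1 := integral_deviation_le q H hD hn hg hg2 ν hν hθ
    refine le_trans ?_ (ha.trans (le_ciSup_finite (fun a => ∑ i, (∫ z, f a z ∂q - f a (S i))) a))
    rw [mul_add]
    exact add_le_add h1 le_rfl
  · refine (Finset.abs_sum_le_sum_abs _ _).trans ?_
    have := Finset.sum_le_card_nsmul Finset.univ (fun i => |∫ z, f a z ∂q - f a (S i)|) (1 - θ)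
      fun i _ => abs_le.2 (by
        constructor <;> linarith [hf0 a (S i), hf1 a (S i), (hfi a).1, (hfi a).2])
    simpa using this
  · refine le_trans ?_ (add_le_add (le_ciSup_finite
      (fun a => ∑ i, (∫ z, f a z ∂q - f a (S i))) a) le_rfl)
    classical
    rw [← Finset.sum_erase_add _ _ (Finset.mem_univ i),
      ← Finset.sum_erase_add _ (fun i => ∫ z, f a z ∂q - f a (S i)) (Finset.mem_univ i),
      Function.update_self]
    have e : ∑ k ∈ Finset.univ.erase i, (∫ z, f a z ∂q - f a (Function.update S i y k)) =
        ∑ k ∈ Finset.univ.erase i, (∫ z, f a z ∂q - f a (S k)) :=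
      Finset.sum_congr rfl fun k hk => by
        rw [Function.update_of_ne (Finset.ne_of_mem_erase hk)]
    rw [e]
    linarith [hf0 a y, hf1 a (S i)]

end RMBoost

namespace RMBoost

variable {X : Type*} [MeasurableSpace X] {T n : ℕ}

/-! ### Uniform deviations over all parameters and constraint levels -/

/-- The sum over the sample of the differences between the expected violation of the constraint
`|ħ(x)ᵀ ν| ≤ θ` and the violation at the sample points. -/
noncomputable def deviation (q : Measure (X × Bool)) (H : BaseRules X T) (θ : ℝ)
    (S : Fin n → X × Bool) (ν : Fin T → ℝ) : ℝ :=
  ∑ i, (∫ z, max (|comb H ν z.1| - θ) 0 ∂q - max (|comb H ν (S i).1| - θ) 0)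

theorem continuous_deviation (q : Measure (X × Bool)) [IsProbabilityMeasure q]
    (H : BaseRules X T) {θ : ℝ} (hθ : 0 ≤ θ) (S : Fin n → X × Bool) :
    Continuous fun ν : {ν : Fin T → ℝ // norm1 ν ≤ 1} => deviation q H θ S ν := by
  have hc : ∀ x, Continuous fun ν : {ν : Fin T → ℝ // norm1 ν ≤ 1} =>
      max (|comb H (ν : Fin T → ℝ) x| - θ) 0 := fun x => by
    have : Continuous fun ν : {ν : Fin T → ℝ // norm1 ν ≤ 1} => comb H (ν : Fin T → ℝ) x :=
      continuous_finsetSum _ fun j _ =>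
        continuous_const.mul ((continuous_apply j).comp continuous_subtype_val)
    exact (this.abs.sub continuous_const).max continuous_const
  have hi : Continuous fun ν : {ν : Fin T → ℝ // norm1 ν ≤ 1} =>
      ∫ z, max (|comb H (ν : Fin T → ℝ) z.1| - θ) 0 ∂q :=
    continuous_of_dominated (bound := fun _ => 1)
      (fun ν => ((measurable_violation H ν θ).comp measurable_fst).aestronglyMeasurable)
      (fun ν => ae_of_all _ fun z => (violation_le H ν hθ z.1).trans ν.2) (integrable_const _)
      (ae_of_all _ fun z => hc z.1)
  exact continuous_finsetSum _ fun i _ => hi.sub (hc _)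

/-- The bound for finite families extends to all parameters, along a dense sequence. -/
theorem measure_deviation_le (q : Measure (X × Bool)) [IsProbabilityMeasure q]
    (H : BaseRules X T) (hD : 1 ≤ vcDim H) (hn : vcDim H ≤ n) {g : ℝ} (hg : 0 < g)
    (hg2 : g ^ 2 * n = 8 * vcDim H * Real.log (3 * n / vcDim H)) {θ : ℝ} (hθ : 0 ≤ θ)
    (hθ1 : θ < 1) {τ : ℝ} (hτ : 0 ≤ τ) :
    Measure.pi (fun _ : Fin n => q) {S | ∃ ν, norm1 ν ≤ 1 ∧
        n * (meanRatio (Real.log (3 * n / vcDim H)) * g + (1 - θ) * τ) < deviation q H θ S ν} ≤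
      ENNReal.ofReal (Real.exp (-2 * n * τ ^ 2)) := by
  set c := n * (meanRatio (Real.log (3 * n / vcDim H)) * g + (1 - θ) * τ)
  have : Nonempty {ν : Fin T → ℝ // norm1 ν ≤ 1} := ⟨⟨0, by simp [norm1]⟩⟩
  set u := TopologicalSpace.denseSeq {ν : Fin T → ℝ // norm1 ν ≤ 1}
  set E : ℕ → Set (Fin n → X × Bool) := fun m =>
    {S | ∃ a : Fin (m + 1), c ≤ deviation q H θ S (u a)} with hE
  have hsub : {S | ∃ ν, norm1 ν ≤ 1 ∧ c < deviation q H θ S ν} ⊆ ⋃ m, E m := by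
    rintro S ⟨ν, hν, h⟩
    obtain ⟨m, hm⟩ := (TopologicalSpace.denseRange_denseSeq
      {ν : Fin T → ℝ // norm1 ν ≤ 1}).exists_mem_open
        (isOpen_lt continuous_const (continuous_deviation q H hθ S)) ⟨⟨ν, hν⟩, h⟩
    exact Set.mem_iUnion.2 ⟨m, Fin.last m, le_of_lt hm⟩
  have hmono : Monotone E := fun m m' hm S ⟨a, ha⟩ =>
    ⟨⟨a, a.2.trans_le (Nat.succ_le_succ hm)⟩, ha⟩
  refine (measure_mono hsub).trans ?_
  rw [hmono.measure_iUnion]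
  refine iSup_le fun m => ?_
  rw [← ofReal_measureReal]
  exact ENNReal.ofReal_le_ofReal (measureReal_deviation_le q H hD hn hg hg2
    (fun a : Fin (m + 1) => (u a : Fin T → ℝ)) (fun a => (u a).2) hθ hθ1 hτ)

theorem exists_grid_point {g θ : ℝ} (hg : 0 < g) (hθ : 0 < θ) (h : g < 1 - θ) :
    ∃ k ∈ Finset.Icc 1 ⌈(1 - g) / (g / 20)⌉₊, θ ≤ k * (g / 20) ∧ k * (g / 20) < θ + g / 20 := by
  have hb : 0 < g / 20 := by positivity
  refine ⟨⌈θ / (g / 20)⌉₊, Finset.mem_Icc.2 ⟨Nat.ceil_pos.2 (by positivity), Nat.ceil_mono ?_⟩,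
    ?_, ?_⟩
  · exact div_le_div_of_nonneg_right (by linarith) hb.le
  · exact (div_le_iff₀ hb).1 (Nat.le_ceil _)
  · have := Nat.ceil_lt_add_one (div_nonneg hθ.le hb.le)
    have := mul_lt_mul_of_pos_right this hb
    rwa [add_mul, div_mul_cancel₀ _ hb.ne', one_mul] at this

/-- A violation with expectation larger than `g + (1 - θ) * M` at a level `θ`, and with no
violation at the sample, gives a large deviation at the next level of the grid. -/
theorem lt_deviation_of_lt_integral {q : Measure (X × Bool)} [IsProbabilityMeasure q]
    {H : BaseRules X T} (hn : 1 ≤ n) {S : Fin n → X × Bool} {ν : Fin T → ℝ} {θ θ' g M : ℝ}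
    (hM : 0 ≤ M) (hθ : 0 ≤ θ) (h1 : θ ≤ θ') (h2 : θ' ≤ θ + g / 20)
    (hS : ∀ i, |comb H ν (S i).1| ≤ θ)
    (h : g + (1 - θ) * M < ∫ z, max (|comb H ν z.1| - θ) 0 ∂q) :
    n * (0.95 * g + (1 - θ') * M) < deviation q H θ' S ν := by
  have hn0 : (0 : ℝ) < n := by exact_mod_cast hn
  have hi : ∀ t, 0 ≤ t → Integrable (fun z : X × Bool => max (|comb H ν z.1| - t) 0) q :=
    fun t ht => Integrable.of_bound
      ((measurable_violation H ν t).comp measurable_fst).aestronglyMeasurable (norm1 ν)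
      (ae_of_all _ fun z => violation_le H ν ht z.1)
  have e : deviation q H θ' S ν = n * ∫ z, max (|comb H ν z.1| - θ') 0 ∂q := by
    have : ∀ i, max (|comb H ν (S i).1| - θ') 0 = 0 := fun i =>
      max_eq_right (by linarith [hS i])
    simp [deviation, this]
  rw [e]
  refine mul_lt_mul_of_pos_left ?_ hn0
  have h3 : ∫ z, max (|comb H ν z.1| - θ) 0 ∂q ≤
      ∫ z, (max (|comb H ν z.1| - θ') 0 + g / 20) ∂q :=
    integral_mono (hi θ hθ) ((hi θ' (hθ.trans h1)).add (integrable_const _)) fun z =>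
      max_le (by linarith [le_max_left (|comb H ν z.1| - θ') 0])
        (by linarith [le_max_right (|comb H ν z.1| - θ') 0])
  rw [integral_add (hi θ' (hθ.trans h1)) (integrable_const _)] at h3
  simp only [integral_const, probReal_univ, smul_eq_mul, one_mul] at h3
  have h4 : (1 - θ') * M ≤ (1 - θ) * M := mul_le_mul_of_nonneg_right (by linarith) hM
  linarith

theorem integral_violation_le (q : Measure (X × Bool)) [IsProbabilityMeasure q]
    (H : BaseRules X T) {ν : Fin T → ℝ} (hν : norm1 ν ≤ 1) {θ : ℝ} (hθ : θ ≤ 1) :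
    ∫ z, max (|comb H ν z.1| - θ) 0 ∂q ≤ 1 - θ := by
  have := integral_mono_of_nonneg (μ := q)
    (ae_of_all _ fun z : X × Bool => le_max_right (|comb H ν z.1| - θ) 0)
    (integrable_const (1 - θ)) (ae_of_all _ fun z => max_sub_le_of_norm1_le H hν hθ z.1)
  simpa using this

/-- With probability at least `1 - δ`, every constraint `|ħ(x)ᵀ ν| ≤ θ` that holds at the sample has
expected violation at most `g + (1 - θ) * M`. The union bound over the grid of levels is paid for by
the part of `g` that exceeds the bound for the expected deviation. -/
theorem measure_exists_violation_le (q : Measure (X × Bool)) [IsProbabilityMeasure q]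
    (H : BaseRules X T) (hD : 1 ≤ vcDim H) (hn : vcDim H ≤ n) {δ : ℝ} (hδ : 0 < δ) (hδ1 : δ < 1) :
    Measure.pi (fun _ : Fin n => q) {S | ∃ ν θ, norm1 ν ≤ 1 ∧ 0 < θ ∧ θ < 1 ∧
        (∀ i, |comb H ν (S i).1| ≤ θ) ∧
        2 * √(2 * vcDim H * Real.log (3 * n / vcDim H) / n) +
          (1 - θ) * √(Real.log (1 / δ) / (2 * n)) < ∫ z, max (|comb H ν z.1| - θ) 0 ∂q} ≤
      ENNReal.ofReal δ := by
  set D := vcDim H with hDdef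
  set L := Real.log (3 * n / D) with hLdef
  set g := 2 * √(2 * D * L / n) with hgdef
  set M := √(Real.log (1 / δ) / (2 * n)) with hMdef
  have hD1 : (1 : ℝ) ≤ D := by exact_mod_cast hD
  have hDn : (D : ℝ) ≤ n := by exact_mod_cast hn
  have hD0 : (0 : ℝ) < D := by linarith
  have hn0 : (0 : ℝ) < n := by linarith
  have hM0 : 0 ≤ M := Real.sqrt_nonneg _
  have hL1 : 1 ≤ L := by
    rw [hLdef, Real.le_log_iff_exp_le (by positivity)]
    have h3 : (3 : ℝ) ≤ 3 * n / D := by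
      rw [le_div_iff₀ hD0]
      linarith
    linarith [Real.exp_one_lt_d9]
  have hg0 : 0 < g := by positivity
  have hg2 : g ^ 2 * n = 8 * D * L := by
    rw [hgdef, mul_pow, Real.sq_sqrt (by positivity)]
    field_simp
    ring
  rcases le_or_gt 1 g with hg1 | hg1
  · -- the expected violation is at most `1 - θ`
    refine le_of_eq_of_le (measure_mono_null ?_ measure_empty) zero_le
    rw [Set.subset_empty_iff, Set.eq_empty_iff_forall_notMem]
    rintro S ⟨ν, θ, hν, hθ0, hθ1, -, h⟩
    have := integral_violation_le q H hν hθ1.le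
    have : 0 ≤ (1 - θ) * M := mul_nonneg (by linarith) hM0
    linarith
  have hexpL : Real.exp L = 3 * n / D := Real.exp_log (by positivity)
  have hgL : g ^ 2 * Real.exp L = 24 * L := by
    rw [hexpL, mul_div_assoc', div_eq_iff hD0.ne']
    linarith
  have hL : 4.7 ≤ L := by
    refine (lt_of_mul_lt_exp hL1 ?_).le
    rw [← hgL]
    have : g ^ 2 < 1 := by nlinarith
    nlinarith [Real.exp_pos L]
  set τ := M + (0.95 - meanRatio L) * g with hτdef
  have hr : 0 ≤ 0.95 - meanRatio L := by linarith [meanRatio_le hL]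
  have hrg : 0 ≤ (0.95 - meanRatio L) * g := mul_nonneg hr hg0.le
  have hτ : 0 ≤ τ := add_nonneg hM0 hrg
  have hK : (⌈(1 - g) / (g / 20)⌉₊ : ℝ) ≤ Real.exp (0.81 * L - 2.09) := by
    refine le_trans ?_ (grid_card_le_exp hg0 hL hgL)
    have h1 := Nat.ceil_lt_add_one (show 0 ≤ (1 - g) / (g / 20) from
      div_nonneg (by linarith) (by positivity))
    have h2 : (1 - g) / (g / 20) + 1 = 20 / g - 19 := by
      field_simp
      ring
    linarith
  have hexp : Real.exp (-2 * n * τ ^ 2) ≤ δ * Real.exp (-(0.81 * L - 2.09)) := by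
    have h1 : -2 * n * M ^ 2 = Real.log δ := by
      rw [hMdef, Real.sq_sqrt, one_div, Real.log_inv]
      · field_simp
      · exact div_nonneg (Real.log_nonneg (by rw [le_div_iff₀ hδ]; linarith)) (by positivity)
    have h2 : 0.81 * L - 2.09 ≤ 2 * n * ((0.95 - meanRatio L) * g) ^ 2 := by
      have e : 2 * n * ((0.95 - meanRatio L) * g) ^ 2 =
          D * (16 * L * (0.95 - meanRatio L) ^ 2) := by
        rw [mul_pow]
        linear_combination 2 * (0.95 - meanRatio L) ^ 2 * hg2
      rw [e]
      refine (exponent_ge hL).trans (le_mul_of_one_le_left ?_ hD1)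
      exact mul_nonneg (by linarith) (sq_nonneg _)
    rw [← Real.exp_log hδ, ← Real.exp_add, Real.exp_le_exp, ← h1]
    have h3 : 0 ≤ n * (M * ((0.95 - meanRatio L) * g)) := by positivity
    rw [hτdef]
    nlinarith
  set B : ℕ → Set (Fin n → X × Bool) := fun k => {S | k * (g / 20) < 1 ∧ ∃ ν, norm1 ν ≤ 1 ∧
    n * (meanRatio L * g + (1 - k * (g / 20)) * τ) < deviation q H (k * (g / 20)) S ν} with hB
  have hBk : ∀ k, Measure.pi (fun _ : Fin n => q) (B k) ≤
      ENNReal.ofReal (Real.exp (-2 * n * τ ^ 2)) := fun k => by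
    by_cases hk : k * (g / 20) < 1
    · refine (measure_mono fun S hS => hS.2).trans
        (measure_deviation_le q H hD hn hg0 hg2 (by positivity) hk hτ)
    · have : B k = ∅ := Set.eq_empty_iff_forall_notMem.2 fun S hS => hk hS.1
      simp [this]
  refine (measure_mono (t := ⋃ k ∈ Finset.Icc 1 ⌈(1 - g) / (g / 20)⌉₊, B k) ?_).trans
    ((measure_biUnion_finset_le _ _).trans ((Finset.sum_le_sum fun k _ => hBk k).trans ?_))
  · rintro S ⟨ν, θ, hν, hθ0, hθ1, hS, h⟩
    have h1 := integral_violation_le q H hν hθ1.le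
    have h2 : 0 ≤ (1 - θ) * M := mul_nonneg (by linarith) hM0
    obtain ⟨k, hk, hk1, hk2⟩ := exists_grid_point hg0 hθ0 (by linarith : g < 1 - θ)
    refine Set.mem_biUnion hk ⟨by linarith, ν, hν, lt_of_le_of_lt ?_
      (lt_deviation_of_lt_integral (by omega) hM0 hθ0.le hk1 hk2.le hS h)⟩
    refine mul_le_mul_of_nonneg_left ?_ hn0.le
    have h3 : (1 - k * (g / 20)) * ((0.95 - meanRatio L) * g) ≤ (0.95 - meanRatio L) * g :=
      mul_le_of_le_one_left hrg (by linarith)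
    rw [hτdef]
    linarith
  · rw [Finset.sum_const, Nat.card_Icc, Nat.add_sub_cancel, nsmul_eq_mul,
      ← ENNReal.ofReal_natCast, ← ENNReal.ofReal_mul (Nat.cast_nonneg _)]
    refine ENNReal.ofReal_le_ofReal ((mul_le_mul hK hexp (Real.exp_pos _).le
      (Real.exp_pos _).le).trans (le_of_eq ?_))
    rw [mul_left_comm, ← Real.exp_add]
    simp

theorem epsDelta_nonneg (n D : ℕ) (δ C : ℝ) : 0 ≤ epsDelta n D δ C := by
  unfold epsDelta
  split_ifs with h
  · exact le_rfl
  · have : 0 ≤ C - 1 / 2 := by linarith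
    have : 0 ≤ C := by linarith
    positivity

/-- With probability at least `1 - δ`, each parameter `μ` that satisfies the constraints at the
sample has expected constraint violation at most `ε(δ)`. -/
theorem measure_epsDelta_lt_violation_le (q : Measure (X × Bool)) [IsProbabilityMeasure q]
    (H : BaseRules X T) (hD : vcDim H ≤ n) {δ : ℝ} (hδ : 0 < δ) (hδ1 : δ < 1) :
    Measure.pi (fun _ : Fin n => q) {S | ∃ μ, (∀ i, |comb H μ (S i).1| ≤ 1 / 2) ∧
        epsDelta n (vcDim H) δ (norm1 μ) < ∫ z, max (|comb H μ z.1| - 1 / 2) 0 ∂q} ≤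
      ENNReal.ofReal δ := by
  -- a parameter with large expected violation violates the constraint at some instance
  have hpos : ∀ μ, epsDelta n (vcDim H) δ (norm1 μ) < ∫ z, max (|comb H μ z.1| - 1 / 2) 0 ∂q →
      ¬ ∀ x, |comb H μ x| ≤ 1 / 2 := fun μ h hall => by
    have e : ∀ z : X × Bool, max (|comb H μ z.1| - 1 / 2) 0 = 0 := fun z =>
      max_eq_right (by linarith [hall z.1])
    simp only [e, integral_zero] at h
    exact absurd h (epsDelta_nonneg _ _ _ _).not_gt
  rcases Nat.eq_zero_or_pos (vcDim H) with h0 | h0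
  · refine le_of_eq_of_le (measure_mono_null ?_ measure_empty) zero_le
    rw [Set.subset_empty_iff, Set.eq_empty_iff_forall_notMem]
    rintro S ⟨μ, -, h⟩
    refine hpos μ h fun x => ?_
    simp [comb, rule_eq_zero_of_vcDim h0]
  refine (measure_mono ?_).trans (measure_exists_violation_le q H h0 hD hδ hδ1)
  rintro S ⟨μ, hS, h⟩
  have hC : ¬ norm1 μ ≤ 1 / 2 := fun hC => hpos μ h fun x => (abs_comb_le H μ x).trans hC
  rw [epsDelta, if_neg hC] at h
  set C := norm1 μ with hCdef
  have hC0 : 0 < C := by linarith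
  have hCi : 0 < C⁻¹ := inv_pos.2 hC0
  have hcomb : ∀ x, |comb H (C⁻¹ • μ) x| = C⁻¹ * |comb H μ x| := fun x => by
    rw [comb_smul, abs_mul, abs_of_pos hCi]
  refine ⟨C⁻¹ • μ, C⁻¹ * (1 / 2), ?_, by positivity, ?_, fun i => ?_, ?_⟩
  · rw [norm1_smul, abs_of_pos hCi, ← hCdef, inv_mul_cancel₀ hC0.ne']
  · rw [inv_mul_lt_iff₀ hC0]
    linarith
  · rw [hcomb]
    exact mul_le_mul_of_nonneg_left (hS i) hCi.le
  · have e : ∀ z : X × Bool, max (|comb H (C⁻¹ • μ) z.1| - C⁻¹ * (1 / 2)) 0 =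
        C⁻¹ * max (|comb H μ z.1| - 1 / 2) 0 := fun z => by
      rw [hcomb, mul_max_of_nonneg _ _ hCi.le, mul_zero, mul_sub]
    simp only [e]
    rw [integral_const_mul]
    refine lt_of_eq_of_lt ?_ (mul_lt_mul_of_pos_left h hCi)
    field_simp

end RMBoost

theorem theorem4 {X : Type*} [MeasurableSpace X] (T n : ℕ) (H : RMBoost.BaseRules X T)
    (p : MeasureTheory.Measure (X × Bool)) (hp : MeasureTheory.IsProbabilityMeasure p)
    (ρ : Bool → X → ℝ) (hρ_meas : ∀ y, Measurable (ρ y))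
    (hρ_nonneg : ∀ y x, 0 ≤ ρ y x) (hρ_le : ∀ y x, ρ y x ≤ 1)
    (lam : ℝ) (hlam : 0 < lam) (hn : 1 ≤ n) (hD : RMBoost.vcDim H ≤ n)
    (δ : ℝ) (hδ : 0 < δ) (hδ1 : δ < 1) :
    MeasureTheory.Measure.pi (fun _ : Fin n => RMBoost.trainDist p ρ)
      {S : Fin n → X × Bool | ¬ (
        (∀ (k : ℕ) (s : RMBoost.State T n), RMBoost.Reaches H S lam k s →
          ∀ εest : ℝ, RMBoost.IsEstBound H (RMBoost.trainDist p ρ) S εest →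
            RMBoost.risk p (RMBoost.ruleOf H s.μ) ≤
              s.R + RMBoost.epsDelta n (RMBoost.vcDim H) δ (RMBoost.norm1 s.μ) +
                (εest + 2 * RMBoost.pNoise p ρ - lam) * RMBoost.norm1 s.μ) ∧
        (∀ (k : ℕ) (j : Fin T) (s : RMBoost.State T n), RMBoost.StopsAt H S lam k j s →
          RMBoost.IsExactChoice H S s j →
            RMBoost.IsOptSolution H p S lam
              (RMBoost.epsDelta n (RMBoost.vcDim H) δ (RMBoost.norm1 s.μ)) s.μ))}
      ≤ ENNReal.ofReal δ := by
  have := RMBoost.isProbabilityMeasure_trainDist p hρ_meas hρ_nonneg hρ_le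
  refine (measure_mono fun S hS => ?_).trans
    (RMBoost.measure_epsDelta_lt_violation_le (RMBoost.trainDist p ρ) H hD hδ hδ1)
  by_contra hgood
  refine hS ?_
  have hv : ∀ k s, RMBoost.Reaches H S lam k s →
      ∫ x, max (|RMBoost.comb H s.μ x| - 1 / 2) 0 ∂(p.map Prod.fst) ≤
        RMBoost.epsDelta n (RMBoost.vcDim H) δ (RMBoost.norm1 s.μ) := fun k s hs => by
    rw [RMBoost.integral_trainDist_fst p hρ_meas hρ_nonneg hρ_le
      (RMBoost.measurable_violation H s.μ (1 / 2))
      (RMBoost.violation_le H s.μ (by norm_num))]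
    exact not_lt.1 fun h => hgood ⟨s.μ, hs.abs_comb_le, h⟩
  refine ⟨fun k s hs ε hε => ?_, ?_⟩
  · have h1 := RMBoost.risk_ruleOf_le_objective H p hρ_meas hρ_nonneg hρ_le lam hε s.μ
    have h2 := hs.objective_le hlam.le
    have h3 := hv k s hs
    linarith
  · rintro k j s ⟨k', -, hs, hj⟩ hex
    have h1 := hs.objective_le_minimaxRisk hlam.le hn fun j' => (hex j').trans hj
    have h2 := hv k' s hs
    rw [RMBoost.IsOptSolution]
    linarith
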